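/- **Setting.** Let $L>0$ and let $\epsilon,\mu:\mathbb R^2\to\mathbb R$ be measurable, $2\pi$-periodic in $x$, equal to constants $\epsilon_0,\mu_0$ for $|z|\ge L$, and bounded above and below by positive constants. Put $\Omega=(-\pi,\pi)\times(-L,L)$, $\Gamma_\pm=\{(x,\pm L):-\pi<x<\pi\}$, $\Gamma=\Gamma_+\cup\Gamma_-$, and $$H^1_{\rm per}(\Omega)=\{u\in H^1(\Omega): u(\pi,z)=u(-\pi,z)\text{ for a.e. } z\in(-L,L)\ \text{in the sense of traces}\}$$ with the inner product $(u,v)=\int_\Omega (u\bar v+\nabla u\cdot\nabla\bar v)$. For $u\in H^1_{\rm per}(\Omega)$ let $\hat u_m^\pm$ be the Fourier coefficients of its trace on $\Gamma_\pm$: $u(x,\pm L)=\sum_{m\in\mathbb Z}\hat u_m^\pm e^{imx}$. For $(\kappa,\omega)\in\mathbb C^2$ and $m\in\mathbb Z$ put $\eta_m^2=\epsilon_0\mu_0\omega^2-(m+\kappa)^2$. A *branch* of the exponents on an open set $U\subset\mathbb C^2$ is a family of analytic functions $\eta_m$ $(m\in\mathbb Z)$ on $U$ with $\eta_m(\kappa,\omega)^2=\epsilon_0\mu_0\omega^2-(m+\kappa)^2\neq0$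 for all $m$ and all $(\kappa,\omega)\in U$. The *outgoing* choice takes the square root with cut on the negative imaginary axis, so that $\eta_m>0$ if $\eta_m^2>0$ and $\eta_m=i|\eta_m|$ if $\eta_m^2<0$. With $\boldsymbol\kappa=(\kappa,0)$ and the Dirichlet-to-Neumann map $\widehat{(Nf)}{}_m^\pm=-i\eta_m\hat f_m^\pm$ set $$h(u,v)=\int_\Omega\mu^{-1}(\nabla+i\boldsymbol\kappa)u\cdot(\nabla-i\boldsymbol\kappa)\bar v+\mu_0^{-1}\int_\Gamma (Nu)\bar v,\qquad \int_\Gamma (Nu)\bar v=2\pi\sum_{m\in\mathbb Z}\sum_{\pm}(-i\eta_m)\,\hat u_m^\pm\,\overline{\hat v_m^\pm},$$ $$b(u,v)=\int_\Omega\epsilon\,u\bar v,\qquad c_1=h+b,\qquad c_2=-(\omega^2+1)\,b,$$ and let $C_1,C_2$ be the bounded operators on $H^1_{\rm per}(\Omega)$ with $(C_ju,v)=c_j(u,v)$. Where $C_1$ is invertible, put $A=I+C_1^{-1}C_2$. **Lemma.** 1. Let $U\subset\mathbb C^2$ be open and $(\eta_m)$ a branch on $U$. Then for every $(\kappa,\omega)\in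 U$ the series for $\int_\Gamma(Nu)\bar v$ converges absolutely for all $u,v\in H^1_{\rm per}(\Omega)$, and bounded operators $C_1,C_2$ representing $c_1,c_2$ exist. The maps $(\kappa,\omega)\mapsto C_1,\,C_2$ are analytic on $U$ (jointly, in operator norm), and $A$ is analytic at every point of $U$ at which $C_1$ is invertible. 2. If $(\kappa_0,\omega_0)\in\mathbb C^2$ is such that $\epsilon_0\mu_0\omega_0^2-(m+\kappa_0)^2\ne0$ for all $m\in\mathbb Z$, then for any choice of the square roots $\eta_m$ at $(\kappa_0,\omega_0)$ there are an open neighborhood $U$ of $(\kappa_0,\omega_0)$ and a branch on $U$ taking these values at $(\kappa_0,\omega_0)$. 3. There is an open set $W\subset\mathbb C^2$, containing every real pair $(\kappa,\omega)$ with $\epsilon_0\mu_0\omega^2-(m+\kappa)^2\ne0$ for all $m\in\mathbb Z$, on which the outgoing $\eta_m$ form a branch, $C_1$ is invertible, and $C_1$, $C_2$ and $A$ are analytic. 4. For every $(\kappa,\omega)$ in $\mathcal D=\{(\kappa,\omega)\in\mathbb R^2:|\kappa|<\tfrac12,\ |\kappa|<\omega\sqrt{\epsilon_0\mu_0}<1-|\kappa|\}$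 one has $\epsilon_0\mu_0\omega^2-(m+\kappa)^2\ne0$ for all $m\in\mathbb Z$. -/

import Mathlib

open MeasureTheory Set Filter Topology
open scoped ContDiff ComplexConjugate

noncomputable section

/-- A two-dimensional periodic dielectric slab: coefficients `ε(x,z)`, `μ(x,z)`, `2π`-periodic in
`x`, equal to the constants `ε₀`, `μ₀` for `|z| ≥ L`, and bounded above and below by positive
numbers. Points of the plane are pairs `(x, z)`. -/
structure Slab where
  L : ℝ
  eps : ℝ × ℝ → ℝ
  mu : ℝ × ℝ → ℝ
  eps0 : ℝ
  mu0 : ℝ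
  L_pos : 0 < L
  eps_measurable : Measurable eps
  mu_measurable : Measurable mu
  eps_periodic : ∀ (n : ℤ) (x z : ℝ), eps (x + 2 * Real.pi * n, z) = eps (x, z)
  mu_periodic : ∀ (n : ℤ) (x z : ℝ), mu (x + 2 * Real.pi * n, z) = mu (x, z)
  eps_ambient : ∀ x z : ℝ, L ≤ |z| → eps (x, z) = eps0
  mu_ambient : ∀ x z : ℝ, L ≤ |z| → mu (x, z) = mu0
  eps_bounds : ∃ a b : ℝ, 0 < a ∧ ∀ q, a < eps q ∧ eps q < b
  mu_bounds : ∃ a b : ℝ, 0 < a ∧ ∀ q, a < mu q ∧ mu q < b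

/-- The branch of the complex square root whose cut is the negative imaginary axis. -/
def sqrtCut (w : ℂ) : ℂ :=
  Complex.exp (Real.pi / 4 * Complex.I) * (-Complex.I * w) ^ (1 / 2 : ℂ)

/-- On positive numbers the branch is the positive square root. -/
theorem sqrtCut_of_pos {t : ℝ} (ht : 0 < t) : sqrtCut t = (√t : ℝ) := by
  have h1 : Complex.arg (-Complex.I * t) = -(Real.pi / 2) := by
    rw [Complex.arg_mul_real ht, Complex.arg_neg_I]
  have h0 : (-Complex.I * (t : ℂ)) ≠ 0 := by simp [ht.ne']
  have h2 : Complex.log (-Complex.I * t) = (Real.log t : ℂ) - Real.pi / 2 * Complex.I := by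
    rw [Complex.log, h1]
    simp [abs_of_pos ht]
    ring
  rw [sqrtCut, Complex.cpow_def_of_ne_zero h0, h2, ← Complex.exp_add, Real.sqrt_eq_rpow,
    Real.rpow_def_of_pos ht, Complex.ofReal_exp]
  congr 1
  push_cast
  ring

/-- On negative numbers the branch is `i` times the positive square root of the modulus. -/
theorem sqrtCut_of_neg {t : ℝ} (ht : 0 < t) : sqrtCut (-t) = Complex.I * (√t : ℝ) := by
  have h1 : Complex.arg (Complex.I * t) = Real.pi / 2 := by
    rw [Complex.arg_mul_real ht, Complex.arg_I]
  have h0 : (Complex.I * (t : ℂ)) ≠ 0 := by simp [ht.ne']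
  have h2 : Complex.log (Complex.I * t) = (Real.log t : ℂ) + Real.pi / 2 * Complex.I := by
    rw [Complex.log, h1]
    simp [abs_of_pos ht]
  rw [sqrtCut, neg_mul_neg, Complex.cpow_def_of_ne_zero h0, h2, ← Complex.exp_add,
    Real.sqrt_eq_rpow, Real.rpow_def_of_pos ht, Complex.ofReal_exp]
  nth_rewrite 3 [← Complex.exp_pi_div_two_mul_I]
  rw [← Complex.exp_add]
  congr 1
  push_cast
  ring

namespace Slab

variable (S : Slab)

/-- The truncated period `Ω = (-π, π) × (-L, L)`. -/
def Omega : Set (ℝ × ℝ) := Ioo (-Real.pi) Real.pi ×ˢ Ioo (-S.L) S.L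

/-- Lebesgue measure on `Ω`. -/
abbrev vol : Measure (ℝ × ℝ) := volume.restrict S.Omega

/-- The complex Hilbert space `L²(Ω)`. -/
abbrev L2 : Type := Lp ℂ 2 S.vol

/-- Test functions: complex-valued, smooth, with compact support in `Ω`. -/
def IsTest (φ : ℝ × ℝ → ℂ) : Prop :=
  ContDiff ℝ ∞ φ ∧ HasCompactSupport φ ∧ tsupport φ ⊆ S.Omega

/-- `g` is the weak derivative of `f` on `Ω` in the direction `e`. -/
def IsWeakDeriv (e : ℝ × ℝ) (f g : S.L2) : Prop :=
  ∀ φ : ℝ × ℝ → ℂ, S.IsTest φ →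
    ∫ q, f q * fderiv ℝ φ q e ∂S.vol = -∫ q, g q * φ q ∂S.vol

/-- Triples `(u, p, q)` of `L²(Ω)`-functions with norm `(‖u‖² + ‖p‖² + ‖q‖²)^(1/2)`. An element `u`
of `H¹(Ω)` is recorded as the triple `(u, ∂ₓu, ∂_z u)`; this norm is then the `H¹(Ω)` norm. -/
abbrev Triple : Type := PiLp 2 (fun _ : Fin 3 => S.L2)

/-- The trace on the vertical side `x = c`, `c = ±π`, of `w = (u, ∂ₓu, ∂_z u)`, as a function
of `z`. Since the derivative of `(x + c) u` in `x` is `u + (x + c) ∂ₓu`, and `x + c` vanishes on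
the opposite side, the formula returns the boundary value of every `u` that is `C¹` up to the
boundary (`traceX_eq`); it is bounded from `H¹(Ω)` to `L²` of the side, hence it is the trace. -/
def traceX (c : ℝ) (w : S.Triple) (z : ℝ) : ℂ :=
  (1 / (2 * Real.pi) : ℝ) *
    ∫ x in Ioo (-Real.pi) Real.pi, (w 0 (x, z) + ((x + c : ℝ) : ℂ) * w 1 (x, z))

/-- The trace on the horizontal side `z = c`, `c = ±L`, of `w = (u, ∂ₓu, ∂_z u)`, as a function
of `x`; compare `traceX` and see `traceZ_eq`. The sides `z = L` and `z = -L` are `Γ₊` and `Γ₋`. -/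
def traceZ (c : ℝ) (w : S.Triple) (x : ℝ) : ℂ :=
  (1 / (2 * S.L) : ℝ) *
    ∫ z in Ioo (-S.L) S.L, (w 0 (x, z) + ((z + c : ℝ) : ℂ) * w 2 (x, z))

end Slab

/-- Integration by parts behind the two trace formulas. -/
theorem slab_trace_aux {a c : ℝ} (ha : 0 < a) (hc : c = a ∨ c = -a) {f f' : ℝ → ℂ}
    (hf : ∀ t, HasDerivAt f (f' t) t) (hf' : Continuous f') :
    (1 / (2 * a) : ℝ) * ∫ t in Ioo (-a) a, (f t + ((t + c : ℝ) : ℂ) * f' t) = f c := by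
  have hd : ∀ t, HasDerivAt (fun t : ℝ => ((t + c : ℝ) : ℂ) * f t)
      (f t + ((t + c : ℝ) : ℂ) * f' t) t := by
    intro t
    have h1 : HasDerivAt (fun t : ℝ => ((t + c : ℝ) : ℂ)) 1 t := by
      simpa using ((hasDerivAt_id t).add_const c).ofReal_comp
    have h2 := h1.mul (hf t)
    rw [one_mul] at h2
    exact h2
  have hcf : Continuous f := continuous_iff_continuousAt.2 fun t => (hf t).continuousAt
  have hcont : Continuous fun t : ℝ => f t + ((t + c : ℝ) : ℂ) * f' t := by fun_prop
  rw [← integral_Ioc_eq_integral_Ioo, ← intervalIntegral.integral_of_le (by linarith),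
    intervalIntegral.integral_eq_sub_of_hasDerivAt (fun t _ => hd t)
      (hcont.intervalIntegrable _ _)]
  have ha' : (a : ℂ) ≠ 0 := by exact_mod_cast ha.ne'
  rcases hc with rfl | rfl
  · push_cast; field_simp; ring
  · push_cast; field_simp; ring

namespace Slab

variable (S : Slab)

theorem vol_eq : S.vol = (volume.restrict (Ioo (-Real.pi) Real.pi)).prod
    (volume.restrict (Ioo (-S.L) S.L)) := by
  unfold vol Omega
  rw [Measure.volume_eq_prod, Measure.prod_restrict]

instance : IsFiniteMeasure S.vol := by
  rw [vol_eq]; infer_instance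

/-- Slices in `x` of an almost everywhere property on `Ω`. -/
theorem ae_slice_x {P : ℝ × ℝ → Prop} (h : ∀ᵐ q ∂S.vol, P q) :
    ∀ᵐ z ∂volume.restrict (Ioo (-S.L) S.L),
      ∀ᵐ x ∂volume.restrict (Ioo (-Real.pi) Real.pi), P (x, z) := by
  rw [vol_eq] at h
  rw [← Measure.prod_swap] at h
  exact Measure.ae_ae_of_ae_prod (ae_of_ae_map measurable_swap.aemeasurable h)

/-- Slices in `z` of an almost everywhere property on `Ω`. -/
theorem ae_slice_z {P : ℝ × ℝ → Prop} (h : ∀ᵐ q ∂S.vol, P q) :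
    ∀ᵐ x ∂volume.restrict (Ioo (-Real.pi) Real.pi),
      ∀ᵐ z ∂volume.restrict (Ioo (-S.L) S.L), P (x, z) := by
  rw [vol_eq] at h
  exact Measure.ae_ae_of_ae_prod h

/-- `traceX` returns the boundary values of functions that are `C¹` up to the boundary. -/
theorem traceX_eq {c : ℝ} (hc : c = Real.pi ∨ c = -Real.pi) (f : ℝ × ℝ → ℂ)
    (hf : ContDiff ℝ 1 f) (w : S.Triple) (h0 : w 0 =ᵐ[S.vol] f)
    (h1 : w 1 =ᵐ[S.vol] fun q => fderiv ℝ f q (1, 0)) :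
    S.traceX c w =ᵐ[volume.restrict (Ioo (-S.L) S.L)] fun z => f (c, z) := by
  filter_upwards [S.ae_slice_x (h0.and h1)] with z hz
  have hd : Continuous fun q => fderiv ℝ f q (1, 0) :=
    (hf.continuous_fderiv one_ne_zero).clm_apply continuous_const
  rw [← slab_trace_aux Real.pi_pos hc (f := fun x => f (x, z))
    (f' := fun x => fderiv ℝ f (x, z) (1, 0)) ?_ (by fun_prop)]
  · unfold traceX
    congr 1
    refine integral_congr_ae ?_
    filter_upwards [hz] with x hx
    rw [hx.1, hx.2]
  · intro t
    have := ((hf.differentiable one_ne_zero) (t, z)).hasFDerivAt.comp_hasDerivAt t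
      ((hasDerivAt_id t).prodMk (hasDerivAt_const t z))
    exact this

/-- `traceZ` returns the boundary values of functions that are `C¹` up to the boundary. -/
theorem traceZ_eq {c : ℝ} (hc : c = S.L ∨ c = -S.L) (f : ℝ × ℝ → ℂ)
    (hf : ContDiff ℝ 1 f) (w : S.Triple) (h0 : w 0 =ᵐ[S.vol] f)
    (h2 : w 2 =ᵐ[S.vol] fun q => fderiv ℝ f q (0, 1)) :
    S.traceZ c w =ᵐ[volume.restrict (Ioo (-Real.pi) Real.pi)] fun x => f (x, c) := by
  filter_upwards [S.ae_slice_z (h0.and h2)] with x hx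
  have hd : Continuous fun q => fderiv ℝ f q (0, 1) :=
    (hf.continuous_fderiv one_ne_zero).clm_apply continuous_const
  rw [← slab_trace_aux S.L_pos hc (f := fun z => f (x, z))
    (f' := fun z => fderiv ℝ f (x, z) (0, 1)) ?_ (by fun_prop)]
  · unfold traceZ
    congr 1
    refine integral_congr_ae ?_
    filter_upwards [hx] with z hz
    rw [hz.1, hz.2]
  · intro t
    have := ((hf.differentiable one_ne_zero) (x, t)).hasFDerivAt.comp_hasDerivAt t
      ((hasDerivAt_const t x).prodMk (hasDerivAt_id t))
    exact this

theorem integrable_L2 (f : S.L2) : Integrable (fun q => f q) S.vol :=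
  (Lp.memLp f).integrable (by norm_num)

theorem integrable_mul_bdd (f : S.L2) {g : ℝ × ℝ → ℂ} (hg : Continuous g)
    (hs : HasCompactSupport g) : Integrable (fun q => f q * g q) S.vol := by
  obtain ⟨C, hC⟩ := hg.bounded_above_of_compact_support hs
  exact (S.integrable_L2 f).mul_bdd (c := C) hg.aestronglyMeasurable (ae_of_all _ hC)

theorem IsTest.deriv_prop {φ : ℝ × ℝ → ℂ} (h : S.IsTest φ) (e : ℝ × ℝ) :
    Continuous (fun q => fderiv ℝ φ q e) ∧ HasCompactSupport (fun q => fderiv ℝ φ q e) :=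
  ⟨(h.1.continuous_fderiv (by simp)).clm_apply continuous_const, h.2.1.fderiv_apply ℝ e⟩

theorem IsWeakDeriv.add {e : ℝ × ℝ} {f f' g g' : S.L2} (h : S.IsWeakDeriv e f g)
    (h' : S.IsWeakDeriv e f' g') : S.IsWeakDeriv e (f + f') (g + g') := by
  intro φ hφ
  obtain ⟨hc, hs⟩ := hφ.deriv_prop S e
  have e1 : ∫ q, (f + f') q * fderiv ℝ φ q e ∂S.vol
      = ∫ q, (f q * fderiv ℝ φ q e + f' q * fderiv ℝ φ q e) ∂S.vol := by
    refine integral_congr_ae ?_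
    filter_upwards [Lp.coeFn_add f f'] with q hq
    rw [hq, Pi.add_apply, add_mul]
  have e2 : ∫ q, (g + g') q * φ q ∂S.vol = ∫ q, (g q * φ q + g' q * φ q) ∂S.vol := by
    refine integral_congr_ae ?_
    filter_upwards [Lp.coeFn_add g g'] with q hq
    rw [hq, Pi.add_apply, add_mul]
  have hφc := hφ.1.continuous
  rw [e1, e2, integral_add (S.integrable_mul_bdd f hc hs) (S.integrable_mul_bdd f' hc hs),
    integral_add (S.integrable_mul_bdd g hφc hφ.2.1) (S.integrable_mul_bdd g' hφc hφ.2.1),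
    h φ hφ, h' φ hφ]
  ring

theorem IsWeakDeriv.smul {e : ℝ × ℝ} {f g : S.L2} (a : ℂ) (h : S.IsWeakDeriv e f g) :
    S.IsWeakDeriv e (a • f) (a • g) := by
  intro φ hφ
  have e1 : ∫ q, (a • f) q * fderiv ℝ φ q e ∂S.vol
      = ∫ q, a * (f q * fderiv ℝ φ q e) ∂S.vol := by
    refine integral_congr_ae ?_
    filter_upwards [Lp.coeFn_smul a f] with q hq
    rw [hq, Pi.smul_apply, smul_eq_mul, mul_assoc]
  have e2 : ∫ q, (a • g) q * φ q ∂S.vol = ∫ q, a * (g q * φ q) ∂S.vol := by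
    refine integral_congr_ae ?_
    filter_upwards [Lp.coeFn_smul a g] with q hq
    rw [hq, Pi.smul_apply, smul_eq_mul, mul_assoc]
  rw [e1, e2, integral_const_mul, integral_const_mul, h φ hφ]
  ring

theorem IsWeakDeriv.zero (e : ℝ × ℝ) : S.IsWeakDeriv e 0 0 := by
  intro φ hφ
  have e1 : ∀ ψ : ℝ × ℝ → ℂ, ∫ q, (0 : S.L2) q * ψ q ∂S.vol = 0 := by
    intro ψ
    rw [← integral_zero (ℝ × ℝ) ℂ (μ := S.vol)]
    refine integral_congr_ae ?_
    filter_upwards [Lp.coeFn_zero ℂ 2 S.vol] with q hq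
    rw [hq]; simp
  rw [e1, e1, neg_zero]

theorem slice_integrable (w : S.Triple) (c : ℝ) :
    ∀ᵐ z ∂volume.restrict (Ioo (-S.L) S.L), Integrable
      (fun x => w 0 (x, z) + ((x + c : ℝ) : ℂ) * w 1 (x, z))
      (volume.restrict (Ioo (-Real.pi) Real.pi)) := by
  have slice : ∀ i, ∀ᵐ z ∂volume.restrict (Ioo (-S.L) S.L), Integrable
      (fun x => w i (x, z)) (volume.restrict (Ioo (-Real.pi) Real.pi)) := by
    intro i
    have key : ∀ g : ℝ × ℝ → ℂ, Integrable g S.vol →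
        ∀ᵐ z ∂volume.restrict (Ioo (-S.L) S.L), Integrable
          (fun x => g (x, z)) (volume.restrict (Ioo (-Real.pi) Real.pi)) := by
      intro g hg
      rw [vol_eq] at hg
      exact hg.prod_left_ae
    exact key _ (S.integrable_L2 (w i))
  filter_upwards [slice 0, slice 1] with z h0 h1
  refine h0.add (Integrable.bdd_mul (c := Real.pi + |c|) h1
    (by fun_prop) ?_)
  filter_upwards [ae_restrict_mem measurableSet_Ioo] with x hx
  rw [Complex.norm_real, Real.norm_eq_abs]
  exact (abs_add_le x c).trans (by gcongr; exact abs_le.2 ⟨hx.1.le, hx.2.le⟩)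

theorem traceX_add (c : ℝ) (w w' : S.Triple) :
    S.traceX c (w + w') =ᵐ[volume.restrict (Ioo (-S.L) S.L)]
      fun z => S.traceX c w z + S.traceX c w' z := by
  filter_upwards [S.slice_integrable w c, S.slice_integrable w' c,
    S.ae_slice_x ((Lp.coeFn_add (w 0) (w' 0)).and (Lp.coeFn_add (w 1) (w' 1)))] with z h h' hz
  unfold traceX
  rw [← mul_add, ← integral_add h h']
  congr 1
  refine integral_congr_ae ?_
  filter_upwards [hz] with x hx
  simp only [PiLp.add_apply, hx.1, hx.2, Pi.add_apply]
  ring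

theorem traceX_smul (c : ℝ) (a : ℂ) (w : S.Triple) :
    S.traceX c (a • w) =ᵐ[volume.restrict (Ioo (-S.L) S.L)] fun z => a * S.traceX c w z := by
  filter_upwards [S.ae_slice_x ((Lp.coeFn_smul a (w 0)).and (Lp.coeFn_smul a (w 1)))] with z hz
  unfold traceX
  rw [mul_left_comm, ← integral_const_mul (μ := volume.restrict (Ioo (-Real.pi) Real.pi)) a]
  congr 1
  refine integral_congr_ae ?_
  filter_upwards [hz] with x hx
  simp only [PiLp.smul_apply, hx.1, hx.2, Pi.smul_apply, smul_eq_mul]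
  ring

/-- The periodic Sobolev space `H¹_per(Ω)`: functions `u ∈ L²(Ω)` with weak derivatives
`∂ₓu, ∂_z u ∈ L²(Ω)` whose traces on `x = π` and `x = -π` agree, with the inner product
`(u, v) = ∫_Ω (u v̄ + ∂ₓu ∂ₓv̄ + ∂_z u ∂_z v̄)` inherited from `Triple`. -/
def H1per : Submodule ℂ S.Triple where
  carrier := {w | S.IsWeakDeriv (1, 0) (w 0) (w 1) ∧ S.IsWeakDeriv (0, 1) (w 0) (w 2) ∧
    S.traceX Real.pi w =ᵐ[volume.restrict (Ioo (-S.L) S.L)] S.traceX (-Real.pi) w}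
  add_mem' := by
    rintro w w' ⟨h1, h2, h3⟩ ⟨h1', h2', h3'⟩
    refine ⟨h1.add S h1', h2.add S h2', ?_⟩
    filter_upwards [h3, h3', S.traceX_add Real.pi w w', S.traceX_add (-Real.pi) w w']
      with z a b c d
    rw [c, d, a, b]
  zero_mem' := by
    refine ⟨IsWeakDeriv.zero S _, IsWeakDeriv.zero S _, ?_⟩
    filter_upwards [S.traceX_smul Real.pi 0 0, S.traceX_smul (-Real.pi) 0 0] with z a b
    simp only [smul_zero, zero_mul] at a b
    rw [a, b]
  smul_mem' := by
    rintro a w ⟨h1, h2, h3⟩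
    refine ⟨h1.smul S a, h2.smul S a, ?_⟩
    filter_upwards [h3, S.traceX_smul Real.pi a w, S.traceX_smul (-Real.pi) a w] with z b c d
    rw [c, d, b]

/-- `η_m² = ε₀ μ₀ ω² - (m + κ)²` at the complex pair `p = (κ, ω)`. -/
def etaSq (m : ℤ) (p : ℂ × ℂ) : ℂ := S.eps0 * S.mu0 * p.2 ^ 2 - (m + p.1) ^ 2

/-- The exponents `η_m(κ, ω)`, with the square root cut along the negative imaginary axis. -/
def eta (m : ℤ) (p : ℂ × ℂ) : ℂ := sqrtCut (S.etaSq m p)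

/-- On `U`, no `η_m²` vanishes and `η` is a family of analytic branches of the square roots of the
numbers `η_m²`. -/
def IsBranch (η : ℤ → ℂ × ℂ → ℂ) (U : Set (ℂ × ℂ)) : Prop :=
  ∀ m : ℤ, AnalyticOnNhd ℂ (η m) U ∧ ∀ p ∈ U, S.etaSq m p ≠ 0 ∧ η m p ^ 2 = S.etaSq m p

/-- The Fourier coefficients `(f̂_m⁺, f̂_m⁻)` of the trace `f` of `u` on `Γ = Γ₊ ∪ Γ₋`, that is,
`f(x, ±L) = ∑_m f̂_m^± exp(imx)`. -/
def gammaCoeff (w : S.Triple) (m : ℤ) : ℂ × ℂ :=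
  ((1 / (2 * Real.pi) : ℝ) * ∫ x in Ioo (-Real.pi) Real.pi,
      S.traceZ S.L w x * Complex.exp (-(Complex.I * m * x)),
   (1 / (2 * Real.pi) : ℝ) * ∫ x in Ioo (-Real.pi) Real.pi,
      S.traceZ (-S.L) w x * Complex.exp (-(Complex.I * m * x)))

end Slab

/-- The Dirichlet-to-Neumann map with exponents `e m`, acting on Fourier coefficients over `Γ`:
multiplication by the symbol `-i η_m`. -/
def dtn (e : ℤ → ℂ) (f : ℤ → ℂ × ℂ) (m : ℤ) : ℂ × ℂ := (-Complex.I * e m) • f m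

/-- The terms of the series for `∫_Γ f ḡ` in terms of the Fourier coefficients of `f` and `g`. -/
def gammaTerm (f g : ℤ → ℂ × ℂ) (m : ℤ) : ℂ :=
  2 * Real.pi * ((f m).1 * conj (g m).1 + (f m).2 * conj (g m).2)

/-- `∫_Γ f ḡ`, the pairing of `H^{-1/2}(Γ)` with `H^{1/2}(Γ)`, in Fourier coefficients. -/
def gammaPair (f g : ℤ → ℂ × ℂ) : ℂ := ∑' m : ℤ, gammaTerm f g m

namespace Slab

variable (S : Slab)

/-- The form `h(u, v) = ∫_Ω μ⁻¹ (∇ + iκ)u · (∇ - iκ)v̄ + μ₀⁻¹ ∫_Γ (N u) v̄`, with `κ = (κ, 0)`, at the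
Bloch wavenumber `k` and with the exponents `e m` in the Dirichlet-to-Neumann map. -/
def h (k : ℂ) (e : ℤ → ℂ) (u v : S.H1per) : ℂ :=
  ∫ q, ((S.mu q)⁻¹ : ℂ) *
      ((u.1 1 q + Complex.I * k * u.1 0 q) * (conj (v.1 1 q) - Complex.I * k * conj (v.1 0 q))
        + u.1 2 q * conj (v.1 2 q)) ∂S.vol
    + (S.mu0 : ℂ)⁻¹ * gammaPair (dtn e (S.gammaCoeff u)) (S.gammaCoeff v)

/-- The form `b(u, v) = ∫_Ω ε u v̄`. -/
def b (u v : S.H1per) : ℂ := ∫ q, (S.eps q : ℂ) * (u.1 0 q * conj (v.1 0 q)) ∂S.vol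

/-- The form `c₁ = h + b` at `p = (κ, ω)`, for the family `η` of exponents. -/
def c1 (η : ℤ → ℂ × ℂ → ℂ) (p : ℂ × ℂ) (u v : S.H1per) : ℂ :=
  S.h p.1 (fun m => η m p) u v + S.b u v

/-- The form `c₂ = -(ω² + 1) b` at `p = (κ, ω)`. -/
def c2 (p : ℂ × ℂ) (u v : S.H1per) : ℂ := -(p.2 ^ 2 + 1) * S.b u v

/-- `T` represents the form `c`: `(T u, v) = c(u, v)`. (Mathlib's inner product is linear in its
second argument.) -/
def Represents (T : S.H1per →L[ℂ] S.H1per) (c : S.H1per → S.H1per → ℂ) : Prop :=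
  ∀ u v, inner ℂ v (T u) = c u v

open Classical in
/-- The bounded operator on `H¹_per(Ω)` that represents the form `c` (it is unique if it exists). -/
def opOf (c : S.H1per → S.H1per → ℂ) : S.H1per →L[ℂ] S.H1per :=
  if hT : ∃ T, S.Represents T c then hT.choose else 0

/-- The operator `C₁(κ, ω)`. -/
def C1 (η : ℤ → ℂ × ℂ → ℂ) (p : ℂ × ℂ) : S.H1per →L[ℂ] S.H1per := S.opOf (S.c1 η p)

/-- The operator `C₂(κ, ω)`. -/
def C2 (p : ℂ × ℂ) : S.H1per →L[ℂ] S.H1per := S.opOf (S.c2 p)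

/-- The operator `A(κ, ω) = I + C₁(κ, ω)⁻¹ C₂(κ, ω)`. -/
def A (η : ℤ → ℂ × ℂ → ℂ) (p : ℂ × ℂ) : S.H1per →L[ℂ] S.H1per :=
  1 + Ring.inverse (S.C1 η p) * S.C2 p

/-- The diamond `𝒟` of real pairs `(κ, ω)` with exactly one propagating harmonic. -/
def diamond : Set (ℝ × ℝ) :=
  {r | |r.1| < 1 / 2 ∧ |r.1| < r.2 * √(S.eps0 * S.mu0) ∧ r.2 * √(S.eps0 * S.mu0) < 1 - |r.1|}

/-- The real pair `(κ, ω)` as a complex pair. -/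
def toComplex (r : ℝ × ℝ) : ℂ × ℂ := ((r.1 : ℂ), (r.2 : ℂ))

end Slab

end

/-!
The volume parts of the forms are bounded on `L²`, so that they are represented by operators, which
depend on `(κ, ω)` through polynomials. What needs an argument is the boundary term: its exponents
`η_m` grow like `|m|`, and they have to be analytic in `(κ, ω)` uniformly in `m`.

*The trace inequality.* For `c = ±L`, the trace coefficients of `u` on the side `z = c` satisfy
`∑ max(1, |m|) |û_m|² ≤ C ‖u‖²` (`Slab.exists_traceCoeff_bound`). Integration by parts up to the
boundary, obtained from the weak derivatives by cutting off (`Slab.IsWeakDeriv.integral_mul_x`,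
`Slab.IsWeakDeriv.integral_mul_z`), expresses `û_m` by inner products of `u` and `∂_z u` with the
modes `((z + c) / 2c)^k exp(imx)`, for any power `k ≥ 1` (`Slab.traceCoeff_eq_pow`), and exchanges a
factor `m` for `∂ₓ`, by periodicity (`Slab.inner_mode_dx`). With `k = max(1, |m|)` the modes have
squared norm of order `1 / |m|`. They are orthogonal, and Bessel's inequality gives the claim.
Hence the boundary term is represented by `Φ(d)`, where `Φ` is linear and continuous in the bounded
sequence `d_m = η_m / max(1, |m|)` (`Slab.exists_boundary_clm`).

*The exponents.* Relative to a base point at which no `η_m²` vanishes, the sequence of ratios of the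
`η_m²` is a polynomial in `(κ, ω)` with values in the Banach algebra `ℓ^∞(ℤ)`. The inverse function
theorem for the square in this algebra gives an analytic square root near the constant sequence `1`;
multiplied by the values at the base point it is a branch, and every branch arises so, because a
continuous square root on a ball is determined by its value at the centre
(`Slab.exists_isBranch`, `Slab.IsBranch.exists_analyticAt_symbol`). Thus `d` is analytic, and so are
`C₁` and, where `C₁` is invertible, `A`.

*Real pairs.* There `Re(-i η_m) ≥ 0` for the outgoing `η_m`, so the form `c₁` is coercive
(`Slab.exists_coercive_c1`) and `C₁` is invertible; invertibility is an open condition. Since the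
`ℓ^∞` square root is uniformly close to `1`, near a real pair all `η_m²` stay off the cut.
-/

open scoped BoundedContinuousFunction

/-! ### Cutoffs of the interval and integration by parts up to the boundary -/

/-- A smooth cutoff of the interval `(-1, 1)`: it vanishes where `1 - t² ≤ 1 / n` and equals `1`
where `1 - t² ≥ 2 / n`. -/
noncomputable def intervalCutoff (n : ℕ) (t : ℝ) : ℝ :=
  Real.smoothTransition (n * (1 - t ^ 2) - 1)

theorem intervalCutoff_contDiff (n : ℕ) : ContDiff ℝ ∞ (intervalCutoff n) := by
  unfold intervalCutoff
  exact Real.smoothTransition.contDiff.comp (by fun_prop)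

theorem intervalCutoff_nonneg (n : ℕ) (t : ℝ) : 0 ≤ intervalCutoff n t :=
  Real.smoothTransition.nonneg _

theorem intervalCutoff_le_one (n : ℕ) (t : ℝ) : intervalCutoff n t ≤ 1 :=
  Real.smoothTransition.le_one _

theorem intervalCutoff_eventually_eq_one {t : ℝ} (ht : t ∈ Ioo (-1 : ℝ) 1) :
    ∀ᶠ n : ℕ in atTop, intervalCutoff n =ᶠ[𝓝 t] fun _ => 1 := by
  have h0 : 0 < 1 - t ^ 2 := by nlinarith [ht.1, ht.2]
  have h1 : Tendsto (fun n : ℕ => (n : ℝ) * (1 - t ^ 2)) atTop atTop :=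
    tendsto_natCast_atTop_atTop.atTop_mul_const h0
  filter_upwards [h1.eventually_gt_atTop 2] with n hn
  have : ∀ᶠ s in 𝓝 t, 2 < (n : ℝ) * (1 - s ^ 2) :=
    (continuous_const.mul (continuous_const.sub (continuous_pow 2))).continuousAt.eventually
      (lt_mem_nhds hn)
  filter_upwards [this] with s hs
  exact Real.smoothTransition.one_of_one_le (by linarith)

theorem lt_of_intervalCutoff_ne_zero {n : ℕ} {t : ℝ} (h : intervalCutoff n t ≠ 0) :
    1 < n * (1 - t ^ 2) := by
  by_contra! hc
  exact h (Real.smoothTransition.zero_of_nonpos (by linarith))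

theorem exists_deriv_smoothTransition_bound :
    ∃ C : ℝ, 0 ≤ C ∧ ∀ x : ℝ, |deriv Real.smoothTransition x| ≤ C ∧
      (1 < x → deriv Real.smoothTransition x = 0) := by
  have hc : Continuous (deriv Real.smoothTransition) :=
    (Real.smoothTransition.contDiff (n := 1)).continuous_deriv le_rfl
  obtain ⟨C, hC⟩ := (isCompact_Icc (a := (0 : ℝ)) (b := 1)).exists_bound_of_continuousOn
    hc.continuousOn
  have hC0 : 0 ≤ C := (norm_nonneg _).trans (hC 0 (by simp))
  have h1 : ∀ x : ℝ, 1 < x → deriv Real.smoothTransition x = 0 := by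
    intro x hx
    have : Real.smoothTransition =ᶠ[𝓝 x] fun _ => 1 := by
      filter_upwards [lt_mem_nhds hx] with y hy
      exact Real.smoothTransition.one_of_one_le hy.le
    rw [this.deriv_eq]; simp
  refine ⟨C, hC0, fun x => ⟨?_, h1 x⟩⟩
  rcases lt_trichotomy x 0 with hx | hx | hx
  · have : Real.smoothTransition =ᶠ[𝓝 x] fun _ => 0 := by
      filter_upwards [gt_mem_nhds hx] with y hy
      exact Real.smoothTransition.zero_of_nonpos hy.le
    rw [this.deriv_eq]; simpa using hC0
  · exact hC x (by simp [hx])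
  · by_cases hx1 : x ≤ 1
    · exact hC x ⟨hx.le, hx1⟩
    · rw [h1 x (not_le.1 hx1)]; simpa using hC0

/-- The slope of the cutoff is at most a constant over the distance to the end points. -/
theorem exists_deriv_intervalCutoff_bound :
    ∃ C : ℝ, 0 ≤ C ∧ ∀ (n : ℕ) (t : ℝ), t ∈ Ioo (-1 : ℝ) 1 →
      |deriv (intervalCutoff n) t| * (1 - t ^ 2) ≤ C := by
  obtain ⟨C, hC0, hC⟩ := exists_deriv_smoothTransition_bound
  refine ⟨C * 4, by positivity, fun n t ht => ?_⟩
  have h0 : 0 < 1 - t ^ 2 := by nlinarith [ht.1, ht.2]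
  have hd : deriv (intervalCutoff n) t
      = deriv Real.smoothTransition (n * (1 - t ^ 2) - 1) * (n * (-(2 * t))) := by
    have h1 : HasDerivAt (fun t : ℝ => (n : ℝ) * (1 - t ^ 2) - 1) (n * (-(2 * t))) t := by
      have := (((hasDerivAt_pow 2 t).const_sub 1).const_mul (n : ℝ)).sub_const 1
      simpa using this
    have h2 : HasDerivAt Real.smoothTransition
        (deriv Real.smoothTransition (n * (1 - t ^ 2) - 1)) (n * (1 - t ^ 2) - 1) :=
      ((Real.smoothTransition.contDiff (n := 1)).differentiable one_ne_zero _).hasDerivAt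
    exact (h2.comp t h1).deriv
  by_cases hx : 1 < (n : ℝ) * (1 - t ^ 2) - 1
  · rw [hd, (hC _).2 hx]; simp; positivity
  · have ht1 : |t| ≤ 1 := abs_le.2 ⟨ht.1.le, ht.2.le⟩
    rw [hd, abs_mul, abs_mul, abs_neg, abs_mul, Nat.abs_cast, abs_two]
    calc |deriv Real.smoothTransition (n * (1 - t ^ 2) - 1)| * (n * (2 * |t|)) * (1 - t ^ 2)
        = |deriv Real.smoothTransition (n * (1 - t ^ 2) - 1)|
            * ((n * (1 - t ^ 2)) * (2 * |t|)) := by ring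
      _ ≤ C * (2 * (2 * 1)) := by
          gcongr
          · exact (hC _).1
          · linarith
      _ = C * 4 := by ring

/-- A smooth function vanishing at `±c` is bounded by a multiple of `1 - (t / c)²`. -/
theorem exists_bound_of_vanishing {c : ℝ} (hc : 0 < c) {b : ℝ → ℂ} (hb : ContDiff ℝ ∞ b)
    (h1 : b c = 0) (h2 : b (-c) = 0) :
    ∃ M : ℝ, ∀ t ∈ Ioo (-c) c, ‖b t‖ ≤ M * (1 - (t / c) ^ 2) := by
  have hd : Continuous (deriv b) := hb.continuous_deriv (by simp)
  obtain ⟨C, hC⟩ := (isCompact_Icc (a := -c) (b := c)).exists_bound_of_continuousOn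
    hd.continuousOn
  have key : ∀ s ∈ Icc (-c) c, ∀ t ∈ Icc (-c) c, ‖b t - b s‖ ≤ C * ‖t - s‖ := fun s hs t ht =>
    (convex_Icc (-c) c).norm_image_sub_le_of_norm_deriv_le
      (fun x _ => (hb.differentiable (by simp)) x) hC hs ht
  have hC0 : 0 ≤ C := (norm_nonneg _).trans (hC 0 ⟨by linarith, hc.le⟩)
  refine ⟨C * c, fun t ht => ?_⟩
  have e : C * c * (1 - (t / c) ^ 2) = C * ((c - t) * (c + t) / c) := by
    field_simp; ring
  rw [e]
  have k1 := key c ⟨by linarith, le_rfl⟩ t ⟨ht.1.le, ht.2.le⟩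
  have k2 := key (-c) ⟨le_rfl, by linarith⟩ t ⟨ht.1.le, ht.2.le⟩
  rw [h1, sub_zero, Real.norm_eq_abs, abs_of_neg (by linarith [ht.2])] at k1
  rw [h2, sub_zero, Real.norm_eq_abs, abs_of_pos (by linarith [ht.1])] at k2
  rcases le_total 0 t with h | h
  · refine k1.trans (mul_le_mul_of_nonneg_left ?_ hC0)
    rw [le_div_iff₀ hc]
    nlinarith [ht.2]
  · refine k2.trans (mul_le_mul_of_nonneg_left ?_ hC0)
    rw [le_div_iff₀ hc]
    nlinarith [ht.1]

namespace Slab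

variable (S : Slab)

/-- The cutoff of `Ω`: the product of the cutoffs of the two sides. -/
noncomputable def cutoff (n : ℕ) (q : ℝ × ℝ) : ℝ :=
  intervalCutoff n (q.1 / Real.pi) * intervalCutoff n (q.2 / S.L)

theorem cutoff_contDiff (n : ℕ) : ContDiff ℝ ∞ (S.cutoff n) := by
  have := intervalCutoff_contDiff n
  unfold cutoff
  exact (this.comp (by fun_prop)).mul (this.comp (by fun_prop))

theorem div_mem_Ioo {a t : ℝ} (ha : 0 < a) : t / a ∈ Ioo (-1 : ℝ) 1 ↔ t ∈ Ioo (-a) a := by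
  rw [mem_Ioo, mem_Ioo, lt_div_iff₀ ha, div_lt_iff₀ ha, one_mul, neg_one_mul]

theorem mem_Omega_iff {q : ℝ × ℝ} :
    q ∈ S.Omega ↔ q.1 / Real.pi ∈ Ioo (-1 : ℝ) 1 ∧ q.2 / S.L ∈ Ioo (-1 : ℝ) 1 := by
  rw [div_mem_Ioo Real.pi_pos, div_mem_Ioo S.L_pos]; rfl

theorem cutoff_support (n : ℕ) :
    HasCompactSupport (S.cutoff n) ∧ tsupport (S.cutoff n) ⊆ S.Omega := by
  set K : Set (ℝ × ℝ) := {q | 1 ≤ n * (1 - (q.1 / Real.pi) ^ 2) ∧ 1 ≤ n * (1 - (q.2 / S.L) ^ 2)}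
    with hK
  have hcl : IsClosed K := by
    have h1 : IsClosed {q : ℝ × ℝ | 1 ≤ n * (1 - (q.1 / Real.pi) ^ 2)} :=
      isClosed_le continuous_const (by fun_prop)
    have h2 : IsClosed {q : ℝ × ℝ | 1 ≤ n * (1 - (q.2 / S.L) ^ 2)} :=
      isClosed_le continuous_const (by fun_prop)
    exact h1.inter h2
  have aux : ∀ t : ℝ, 1 ≤ n * (1 - t ^ 2) → t ∈ Ioo (-1 : ℝ) 1 := by
    intro t ht
    have : 0 < 1 - t ^ 2 := by
      by_contra! h
      have := mul_nonpos_of_nonneg_of_nonpos (Nat.cast_nonneg (α := ℝ) n) h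
      linarith
    rw [mem_Ioo, ← abs_lt]
    exact (sq_lt_one_iff_abs_lt_one t).1 (by linarith)
  have hKO : K ⊆ S.Omega := fun q hq => S.mem_Omega_iff.2 ⟨aux _ hq.1, aux _ hq.2⟩
  have hKc : IsCompact K := by
    refine ((isCompact_Icc (a := -Real.pi) (b := Real.pi)).prod
      (isCompact_Icc (a := -S.L) (b := S.L))).of_isClosed_subset hcl (hKO.trans ?_)
    exact prod_mono Ioo_subset_Icc_self Ioo_subset_Icc_self
  have hs : Function.support (S.cutoff n) ⊆ K := by
    intro q hq
    rw [Function.mem_support] at hq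
    exact ⟨(lt_of_intervalCutoff_ne_zero (left_ne_zero_of_mul hq)).le,
      (lt_of_intervalCutoff_ne_zero (right_ne_zero_of_mul hq)).le⟩
  exact ⟨HasCompactSupport.of_support_subset_isCompact hKc hs, (closure_minimal hs hcl).trans hKO⟩

theorem cutoff_eventually_eq_one {q : ℝ × ℝ} (hq : q ∈ S.Omega) :
    ∀ᶠ n : ℕ in atTop, S.cutoff n =ᶠ[𝓝 q] fun _ => 1 := by
  obtain ⟨h1, h2⟩ := S.mem_Omega_iff.1 hq
  filter_upwards [intervalCutoff_eventually_eq_one h1, intervalCutoff_eventually_eq_one h2]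
    with n a b
  have a' := (show ContinuousAt (fun q : ℝ × ℝ => q.1 / Real.pi) q by fun_prop).eventually a
  have b' := (show ContinuousAt (fun q : ℝ × ℝ => q.2 / S.L) q by fun_prop).eventually b
  filter_upwards [a', b'] with r hr hr'
  rw [cutoff, hr, hr', one_mul]

theorem cutoff_abs_le (n : ℕ) (q : ℝ × ℝ) : |S.cutoff n q| ≤ 1 := by
  rw [cutoff, abs_mul, abs_of_nonneg (intervalCutoff_nonneg _ _),
    abs_of_nonneg (intervalCutoff_nonneg _ _)]
  exact mul_le_one₀ (intervalCutoff_le_one _ _) (intervalCutoff_nonneg _ _)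
    (intervalCutoff_le_one _ _)

theorem cutoff_fderiv (n : ℕ) (q e : ℝ × ℝ) : fderiv ℝ (S.cutoff n) q e
    = deriv (intervalCutoff n) (q.1 / Real.pi) * (e.1 / Real.pi) * intervalCutoff n (q.2 / S.L)
      + intervalCutoff n (q.1 / Real.pi)
        * (deriv (intervalCutoff n) (q.2 / S.L) * (e.2 / S.L)) := by
  have hd : ∀ t, HasDerivAt (intervalCutoff n) (deriv (intervalCutoff n) t) t := fun t =>
    ((intervalCutoff_contDiff n).differentiable (by simp) t).hasDerivAt
  have e1 : HasFDerivAt (fun r : ℝ × ℝ => r.1 / Real.pi)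
      (Real.pi⁻¹ • ContinuousLinearMap.fst ℝ ℝ ℝ) q := by
    simp only [div_eq_inv_mul]
    exact hasFDerivAt_fst.const_mul _
  have e2 : HasFDerivAt (fun r : ℝ × ℝ => r.2 / S.L)
      (S.L⁻¹ • ContinuousLinearMap.snd ℝ ℝ ℝ) q := by
    simp only [div_eq_inv_mul]
    exact hasFDerivAt_snd.const_mul _
  have h1 := (hd (q.1 / Real.pi)).comp_hasFDerivAt q e1
  have h2 := (hd (q.2 / S.L)).comp_hasFDerivAt q e2
  have h3 := h1.mul h2
  have h4 : fderiv ℝ (S.cutoff n) q = _ := h3.fderiv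
  rw [h4]
  simp
  ring

theorem ae_mem_Omega : ∀ᵐ q ∂S.vol, q ∈ S.Omega :=
  ae_restrict_mem (measurableSet_Ioo.prod measurableSet_Ioo)

theorem exists_bound_Omega {F : Type*} [NormedAddCommGroup F] {f : ℝ × ℝ → F}
    (hf : Continuous f) : ∃ C, ∀ q ∈ S.Omega, ‖f q‖ ≤ C := by
  obtain ⟨C, hC⟩ := ((isCompact_Icc (a := -Real.pi) (b := Real.pi)).prod
      (isCompact_Icc (a := -S.L) (b := S.L))).exists_bound_of_continuousOn hf.continuousOn
  exact ⟨C, fun q hq => hC q ⟨Ioo_subset_Icc_self hq.1, Ioo_subset_Icc_self hq.2⟩⟩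

/-- Smooth functions that need not vanish on `∂Ω` may be used as test functions if their products
with the derivatives of the cutoffs stay bounded: these products tend to zero pointwise, and
dominated convergence removes the cutoff. -/
theorem IsWeakDeriv.integral_of_cutoff_bound {e : ℝ × ℝ} {f g : S.L2} (h : S.IsWeakDeriv e f g)
    {φ : ℝ × ℝ → ℂ} (hφ : ContDiff ℝ ∞ φ)
    (hM : ∃ M : ℝ, ∀ (n : ℕ), ∀ q ∈ S.Omega, |fderiv ℝ (S.cutoff n) q e| * ‖φ q‖ ≤ M) :
    ∫ q, f q * fderiv ℝ φ q e ∂S.vol = -∫ q, g q * φ q ∂S.vol := by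
  obtain ⟨M, hM⟩ := hM
  have hφ' : Continuous fun q => fderiv ℝ φ q e :=
    (hφ.continuous_fderiv (by simp)).clm_apply continuous_const
  obtain ⟨C, hC⟩ := S.exists_bound_Omega hφ.continuous
  obtain ⟨C', hC'⟩ := S.exists_bound_Omega hφ'
  have hθ := S.cutoff_contDiff
  have hθ' : ∀ n, Continuous fun q => fderiv ℝ (S.cutoff n) q e := fun n =>
    ((hθ n).continuous_fderiv (by simp)).clm_apply continuous_const
  have hfd : ∀ n q, fderiv ℝ (fun q => S.cutoff n q • φ q) q e
      = S.cutoff n q • fderiv ℝ φ q e + fderiv ℝ (S.cutoff n) q e • φ q := by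
    intro n q
    rw [fderiv_fun_smul ((hθ n).differentiable (by simp) q) (hφ.differentiable (by simp) q)]
    simp
  have htest : ∀ n, S.IsTest fun q => S.cutoff n q • φ q := by
    intro n
    refine ⟨(hθ n).smul hφ, (S.cutoff_support n).1.smul_right, ?_⟩
    exact (closure_mono (Function.support_smul_subset_left _ _)).trans (S.cutoff_support n).2
  have hlim1 : Tendsto (fun n => ∫ q, f q * fderiv ℝ (fun q => S.cutoff n q • φ q) q e ∂S.vol)
      atTop (𝓝 (∫ q, f q * fderiv ℝ φ q e ∂S.vol)) := by
    refine tendsto_integral_of_dominated_convergence (fun q => ‖f q‖ * (C' + M)) ?_ ?_ ?_ ?_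
    · intro n
      simp only [hfd]
      refine (Lp.aestronglyMeasurable f).mul (Continuous.aestronglyMeasurable ?_)
      exact ((hθ n).continuous.smul hφ').add ((hθ' n).smul hφ.continuous)
    · exact (S.integrable_L2 f).norm.mul_const _
    · intro n
      filter_upwards [S.ae_mem_Omega] with q hq
      rw [hfd, norm_mul]
      gcongr
      refine (norm_add_le _ _).trans (add_le_add ?_ ?_)
      · rw [norm_smul]
        exact (mul_le_of_le_one_left (norm_nonneg _) (S.cutoff_abs_le n q)).trans (hC' q hq)
      · rw [norm_smul]; exact hM n q hq
    · filter_upwards [S.ae_mem_Omega] with q hq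
      refine tendsto_nhds_of_eventually_eq ?_
      filter_upwards [S.cutoff_eventually_eq_one hq] with n hn
      rw [hfd, hn.fderiv_eq, hn.eq_of_nhds]
      simp
  have hlim2 : Tendsto (fun n => -∫ q, g q * (S.cutoff n q • φ q) ∂S.vol)
      atTop (𝓝 (-∫ q, g q * φ q ∂S.vol)) := by
    refine (tendsto_integral_of_dominated_convergence (fun q => ‖g q‖ * C) ?_ ?_ ?_ ?_).neg
    · intro n
      exact (Lp.aestronglyMeasurable g).mul
        ((hθ n).continuous.smul hφ.continuous).aestronglyMeasurable
    · exact (S.integrable_L2 g).norm.mul_const _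
    · intro n
      filter_upwards [S.ae_mem_Omega] with q hq
      rw [norm_mul, norm_smul]
      gcongr
      exact (mul_le_of_le_one_left (norm_nonneg _) (S.cutoff_abs_le n q)).trans (hC q hq)
    · filter_upwards [S.ae_mem_Omega] with q hq
      refine tendsto_nhds_of_eventually_eq ?_
      filter_upwards [S.cutoff_eventually_eq_one hq] with n hn
      rw [hn.eq_of_nhds]
      simp
  exact tendsto_nhds_unique (hlim1.congr fun n => h _ (htest n)) hlim2

theorem fderiv_mul_apply {a b : ℝ → ℂ} (ha : ContDiff ℝ ∞ a) (hb : ContDiff ℝ ∞ b)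
    (q e : ℝ × ℝ) : fderiv ℝ (fun q : ℝ × ℝ => a q.1 * b q.2) q e
      = e.1 * (deriv a q.1 * b q.2) + e.2 * (a q.1 * deriv b q.2) := by
  have h1 := (ha.differentiable (by simp) q.1).hasDerivAt.hasFDerivAt.comp q
    (hasFDerivAt_fst (𝕜 := ℝ) (p := q))
  have h2 := (hb.differentiable (by simp) q.2).hasDerivAt.hasFDerivAt.comp q
    (hasFDerivAt_snd (𝕜 := ℝ) (p := q))
  have h4 : fderiv ℝ (fun q : ℝ × ℝ => a q.1 * b q.2) q = _ := (h1.mul h2).fderiv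
  rw [h4]
  simp
  ring

/-- Integration by parts in `x` against `a(x) b(z)` with `a(±π) = 0`. -/
theorem IsWeakDeriv.integral_mul_x {f g : S.L2} (h : S.IsWeakDeriv (1, 0) f g) {a b : ℝ → ℂ}
    (ha : ContDiff ℝ ∞ a) (hb : ContDiff ℝ ∞ b) (h1 : a Real.pi = 0) (h2 : a (-Real.pi) = 0) :
    ∫ q, f q * (deriv a q.1 * b q.2) ∂S.vol = -∫ q, g q * (a q.1 * b q.2) ∂S.vol := by
  have hφ : ContDiff ℝ ∞ fun q : ℝ × ℝ => a q.1 * b q.2 :=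
    (ha.comp contDiff_fst).mul (hb.comp contDiff_snd)
  rw [← h.integral_of_cutoff_bound S hφ]
  · simp [fderiv_mul_apply ha hb]
  obtain ⟨M, hM⟩ := exists_bound_of_vanishing Real.pi_pos ha h1 h2
  obtain ⟨C, hC0, hC⟩ := exists_deriv_intervalCutoff_bound
  obtain ⟨D, hD⟩ := S.exists_bound_Omega (hb.continuous.comp continuous_snd)
  refine ⟨C / Real.pi * (|M| * D), fun n q hq => ?_⟩
  have hq1 := (S.mem_Omega_iff.1 hq).1
  have hpos : 0 ≤ 1 - (q.1 / Real.pi) ^ 2 := by nlinarith [hq1.1, hq1.2]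
  rw [cutoff_fderiv]
  simp only [zero_div, mul_zero, add_zero, abs_mul, norm_mul]
  rw [abs_of_nonneg (intervalCutoff_nonneg _ _), abs_of_pos (one_div_pos.2 Real.pi_pos)]
  calc _ ≤ |deriv (intervalCutoff n) (q.1 / Real.pi)| * (1 / Real.pi) * 1
        * ((|M| * (1 - (q.1 / Real.pi) ^ 2)) * D) := by
        have := Real.pi_pos
        gcongr
        · exact intervalCutoff_le_one _ _
        · exact (hM _ hq.1).trans (by gcongr; exact le_abs_self M)
        · exact hD q hq
    _ = |deriv (intervalCutoff n) (q.1 / Real.pi)| * (1 - (q.1 / Real.pi) ^ 2) / Real.pi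
        * (|M| * D) := by ring
    _ ≤ _ := by
        have : 0 ≤ D := (norm_nonneg _).trans (hD q hq)
        have := Real.pi_pos
        gcongr
        exact hC n _ hq1

/-- Integration by parts in `z` against `a(x) b(z)` with `b(±L) = 0`. -/
theorem IsWeakDeriv.integral_mul_z {f g : S.L2} (h : S.IsWeakDeriv (0, 1) f g) {a b : ℝ → ℂ}
    (ha : ContDiff ℝ ∞ a) (hb : ContDiff ℝ ∞ b) (h1 : b S.L = 0) (h2 : b (-S.L) = 0) :
    ∫ q, f q * (a q.1 * deriv b q.2) ∂S.vol = -∫ q, g q * (a q.1 * b q.2) ∂S.vol := by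
  have hφ : ContDiff ℝ ∞ fun q : ℝ × ℝ => a q.1 * b q.2 :=
    (ha.comp contDiff_fst).mul (hb.comp contDiff_snd)
  rw [← h.integral_of_cutoff_bound S hφ]
  · simp [fderiv_mul_apply ha hb]
  have hL := S.L_pos
  obtain ⟨M, hM⟩ := exists_bound_of_vanishing S.L_pos hb h1 h2
  obtain ⟨C, hC0, hC⟩ := exists_deriv_intervalCutoff_bound
  obtain ⟨D, hD⟩ := S.exists_bound_Omega (ha.continuous.comp continuous_fst)
  refine ⟨C / S.L * (D * |M|), fun n q hq => ?_⟩
  have hq1 := (S.mem_Omega_iff.1 hq).2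
  have hpos : 0 ≤ 1 - (q.2 / S.L) ^ 2 := by nlinarith [hq1.1, hq1.2]
  have hD0 : 0 ≤ D := (norm_nonneg _).trans (hD q hq)
  rw [cutoff_fderiv]
  simp only [zero_div, mul_zero, zero_mul, zero_add, abs_mul, norm_mul]
  rw [abs_of_nonneg (intervalCutoff_nonneg _ _), abs_of_pos (one_div_pos.2 hL)]
  calc _ ≤ 1 * (|deriv (intervalCutoff n) (q.2 / S.L)| * (1 / S.L))
        * (D * (|M| * (1 - (q.2 / S.L) ^ 2))) := by
        gcongr
        · exact intervalCutoff_le_one _ _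
        · exact hD q hq
        · exact (hM _ hq.2).trans (by gcongr; exact le_abs_self M)
    _ = |deriv (intervalCutoff n) (q.2 / S.L)| * (1 - (q.2 / S.L) ^ 2) / S.L
        * (D * |M|) := by ring
    _ ≤ _ := by
        gcongr
        exact hC n _ hq1

end Slab

/-! ### Separated modes on the slab -/

/-- A weighted Bessel inequality for an orthogonal family. -/
theorem sum_mul_norm_inner_sq_le {ι E : Type*} [NormedAddCommGroup E] [InnerProductSpace ℂ E]
    {v : ι → E} {a : ι → ℝ} {C : ℝ} (ho : ∀ i j, i ≠ j → inner ℂ (v i) (v j) = 0)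
    (ha : ∀ i, 0 ≤ a i) (hC0 : 0 ≤ C) (hC : ∀ i, a i * ‖v i‖ ^ 2 ≤ C) (w : E) (s : Finset ι) :
    ∑ i ∈ s, a i * ‖inner ℂ (v i) w‖ ^ 2 ≤ C * ‖w‖ ^ 2 := by
  classical
  set T := ∑ i ∈ s, a i * ‖inner ℂ (v i) w‖ ^ 2 with hT
  have hT0 : 0 ≤ T := Finset.sum_nonneg fun i _ => by have := ha i; positivity
  -- `⟪y, w⟫ = T` and `‖y‖² ≤ C T`, so that Cauchy-Schwarz gives `T ≤ C ‖w‖²`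
  set y : E := ∑ i ∈ s, ((a i : ℂ) * inner ℂ (v i) w) • v i with hy
  have hyw : inner ℂ y w = (T : ℂ) := by
    rw [hy, sum_inner, hT]
    push_cast
    refine Finset.sum_congr rfl fun i _ => ?_
    rw [inner_smul_left, map_mul, Complex.conj_ofReal, mul_assoc, ← Complex.normSq_eq_conj_mul_self,
      Complex.normSq_eq_norm_sq]
    push_cast; rfl
  have hyy : ‖y‖ ^ 2 ≤ C * T := by
    have h1 : (inner ℂ y y : ℂ)
        = ((∑ i ∈ s, a i * (a i * ‖v i‖ ^ 2) * ‖inner ℂ (v i) w‖ ^ 2 : ℝ) : ℂ) := by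
      conv_lhs => rw [hy, sum_inner]
      push_cast
      refine Finset.sum_congr rfl fun i hi => ?_
      rw [inner_sum, Finset.sum_eq_single i]
      · rw [inner_smul_left, inner_smul_right, inner_self_eq_norm_sq_to_K, map_mul,
          Complex.conj_ofReal]
        have := Complex.normSq_eq_conj_mul_self (z := inner ℂ (v i) w)
        rw [Complex.normSq_eq_norm_sq] at this
        push_cast at this
        simp only [Complex.coe_algebraMap]
        linear_combination -(a i : ℂ) ^ 2 * (‖v i‖ : ℂ) ^ 2 * this
      · intro j _ hj
        rw [inner_smul_left, inner_smul_right, ho i j hj.symm]; simp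
      · exact fun h => absurd hi h
    have h2 : ‖y‖ ^ 2 = ∑ i ∈ s, a i * (a i * ‖v i‖ ^ 2) * ‖inner ℂ (v i) w‖ ^ 2 := by
      have h3 := inner_self_eq_norm_sq_to_K (𝕜 := ℂ) y
      rw [h1] at h3
      simp only [Complex.coe_algebraMap] at h3
      exact_mod_cast h3.symm
    rw [h2, hT, Finset.mul_sum]
    refine Finset.sum_le_sum fun i _ => ?_
    have := ha i
    calc a i * (a i * ‖v i‖ ^ 2) * ‖inner ℂ (v i) w‖ ^ 2
        ≤ a i * C * ‖inner ℂ (v i) w‖ ^ 2 := by gcongr; exact hC i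
      _ = _ := by ring
  have h4 : T ≤ ‖y‖ * ‖w‖ := by
    have := norm_inner_le_norm (𝕜 := ℂ) y w
    rwa [hyw, Complex.norm_real, Real.norm_eq_abs, abs_of_nonneg hT0] at this
  rcases hT0.eq_or_lt with h | h
  · rw [← h]; positivity
  · have h5 : T ^ 2 ≤ C * T * ‖w‖ ^ 2 := by
      calc T ^ 2 ≤ (‖y‖ * ‖w‖) ^ 2 := by gcongr
        _ = ‖y‖ ^ 2 * ‖w‖ ^ 2 := by ring
        _ ≤ _ := by gcongr
    nlinarith

theorem integral_exp_int {n : ℤ} (hn : n ≠ 0) :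
    ∫ x in Ioo (-Real.pi) Real.pi, Complex.exp (Complex.I * n * x) = 0 := by
  have hc : Complex.I * n ≠ 0 := mul_ne_zero Complex.I_ne_zero (by exact_mod_cast hn)
  rw [← integral_Ioc_eq_integral_Ioo,
    ← intervalIntegral.integral_of_le (by linarith [Real.pi_pos]), integral_exp_mul_complex hc]
  have : Complex.exp (Complex.I * n * (Real.pi : ℝ))
      = Complex.exp (Complex.I * n * ((-Real.pi : ℝ) : ℂ)) := by
    rw [Complex.exp_eq_exp_iff_exists_int]
    exact ⟨n, by push_cast; ring⟩
  rw [this, sub_self, zero_div]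

/-- The ramp `(z + c) / 2c` runs between `0` and `1`, upwards for `c = a` and downwards for
`c = -a`. -/
theorem integral_ramp_pow {a c : ℝ} (ha : 0 < a) (hc : c = a ∨ c = -a) (k : ℕ) :
    ∫ z in Ioo (-a) a, ((z + c) / (2 * c)) ^ k = 2 * a / (k + 1) := by
  have hc0 : c ≠ 0 := by rcases hc with rfl | rfl <;> simp [ha.ne']
  have hk : (k : ℝ) + 1 ≠ 0 := by positivity
  have hd : ∀ z : ℝ, HasDerivAt (fun z : ℝ => 2 * c / (k + 1) * ((z + c) / (2 * c)) ^ (k + 1))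
      (((z + c) / (2 * c)) ^ k) z := by
    intro z
    have h1 : HasDerivAt (fun z : ℝ => (z + c) / (2 * c)) (1 / (2 * c)) z :=
      ((hasDerivAt_id z).add_const c).div_const _
    refine ((h1.pow (k + 1)).const_mul (2 * c / (k + 1))).congr_deriv ?_
    push_cast
    field_simp
  rw [← integral_Ioc_eq_integral_Ioo, ← intervalIntegral.integral_of_le (by linarith),
    intervalIntegral.integral_eq_sub_of_hasDerivAt (fun z _ => hd z)
      (Continuous.intervalIntegrable (by fun_prop) _ _)]
  rcases hc with rfl | rfl
  · have : (c + c) / (2 * c) = 1 := by field_simp; ring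
    simp [this]
  · have : (-a + -a) / (2 * -a) = 1 := by field_simp; ring
    rw [this, add_neg_cancel, zero_div]
    simp
    ring

namespace Slab

variable (S : Slab)

/-- The function `((z + c) / 2c)^k exp(imx)`. For `c = ±L` the first factor is a power of the
ramp that equals `1` on the side `z = c` of `Ω` and `0` on the side `z = -c`. -/
noncomputable def modeFun (c : ℝ) (m : ℤ) (k : ℕ) (q : ℝ × ℝ) : ℂ :=
  Complex.exp (Complex.I * m * q.1) * ((((q.2 + c) / (2 * c)) ^ k : ℝ) : ℂ)

theorem modeFun_continuous (c : ℝ) (m : ℤ) (k : ℕ) : Continuous (modeFun c m k) := by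
  unfold modeFun
  fun_prop

theorem memLp_of_continuous {f : ℝ × ℝ → ℂ} (hf : Continuous f) : MemLp f 2 S.vol := by
  obtain ⟨C, hC⟩ := S.exists_bound_Omega hf
  refine MemLp.of_bound hf.aestronglyMeasurable C ?_
  filter_upwards [S.ae_mem_Omega] with q hq using hC q hq

/-- `modeFun` as an element of `L²(Ω)`. -/
noncomputable def mode (c : ℝ) (m : ℤ) (k : ℕ) : S.L2 :=
  (S.memLp_of_continuous (modeFun_continuous c m k)).toLp

theorem conj_modeFun (c : ℝ) (m : ℤ) (k : ℕ) (q : ℝ × ℝ) : conj (modeFun c m k q)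
    = Complex.exp (-(Complex.I * m * q.1)) * ((((q.2 + c) / (2 * c)) ^ k : ℝ) : ℂ) := by
  rw [modeFun, map_mul, Complex.conj_ofReal, ← Complex.exp_conj]
  simp

theorem inner_mode (c : ℝ) (m : ℤ) (k : ℕ) (f : S.L2) : inner ℂ (S.mode c m k) f
    = ∫ q, f q * (Complex.exp (-(Complex.I * m * q.1)) * ((((q.2 + c) / (2 * c)) ^ k : ℝ) : ℂ))
      ∂S.vol := by
  rw [L2.inner_def]
  refine integral_congr_ae ?_
  filter_upwards [(S.memLp_of_continuous (modeFun_continuous c m k)).coeFn_toLp] with q hq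
  rw [mode, hq, RCLike.inner_apply, ← conj_modeFun]

theorem inner_mode_mode {c : ℝ} (hc : c = S.L ∨ c = -S.L) (m n : ℤ) (k l : ℕ) :
    inner ℂ (S.mode c m k) (S.mode c n l)
      = (∫ x in Ioo (-Real.pi) Real.pi, Complex.exp (Complex.I * (n - m : ℤ) * x))
        * ((2 * S.L / ((k + l : ℕ) + 1) : ℝ) : ℂ) := by
  rw [← integral_ramp_pow S.L_pos hc (k + l), ← integral_complex_ofReal,
    ← integral_prod_mul, ← vol_eq, inner_mode]
  refine integral_congr_ae ?_
  filter_upwards [(S.memLp_of_continuous (modeFun_continuous c n l)).coeFn_toLp] with q hq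
  rw [mode, hq, modeFun, pow_add]
  have : Complex.exp (Complex.I * (n - m : ℤ) * q.1)
      = Complex.exp (Complex.I * n * q.1) * Complex.exp (-(Complex.I * m * q.1)) := by
    rw [← Complex.exp_add]; congr 1; push_cast; ring
  rw [this]
  push_cast
  ring

theorem inner_mode_of_ne {c : ℝ} (hc : c = S.L ∨ c = -S.L) {m n : ℤ} (h : m ≠ n) (k l : ℕ) :
    inner ℂ (S.mode c m k) (S.mode c n l) = 0 := by
  rw [S.inner_mode_mode hc, integral_exp_int (sub_ne_zero.2 h.symm), zero_mul]

theorem norm_mode_sq {c : ℝ} (hc : c = S.L ∨ c = -S.L) (m : ℤ) (k : ℕ) :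
    ‖S.mode c m k‖ ^ 2 = 2 * Real.pi * (2 * S.L / (2 * k + 1)) := by
  have h := inner_self_eq_norm_sq_to_K (𝕜 := ℂ) (S.mode c m k)
  have hpi : 0 < Real.pi := Real.pi_pos
  rw [S.inner_mode_mode hc] at h
  simp only [sub_self, Int.cast_zero, mul_zero, zero_mul, Complex.exp_zero, Complex.coe_algebraMap]
    at h
  rw [setIntegral_const, Measure.real, Real.volume_Ioo, ENNReal.toReal_ofReal (by linarith)] at h
  have h' : (((Real.pi - -Real.pi) * (2 * S.L / ((k + k : ℕ) + 1)) : ℝ) : ℂ)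
      = ((‖S.mode c m k‖ ^ 2 : ℝ) : ℂ) := by
    rw [Complex.ofReal_pow, ← h, Complex.ofReal_mul]; simp
  rw [← Complex.ofReal_injective h']
  push_cast
  ring

/-! ### Periodicity -/

/-- The traces on the two vertical sides differ by the integral of `∂ₓu`. -/
theorem traceX_eq_iff (w : S.Triple) :
    S.traceX Real.pi w =ᵐ[volume.restrict (Ioo (-S.L) S.L)] S.traceX (-Real.pi) w ↔
    (fun z => ∫ x in Ioo (-Real.pi) Real.pi, w 1 (x, z))
      =ᵐ[volume.restrict (Ioo (-S.L) S.L)] 0 := by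
  have key : ∀ᵐ z ∂volume.restrict (Ioo (-S.L) S.L), S.traceX Real.pi w z - S.traceX (-Real.pi) w z
      = ∫ x in Ioo (-Real.pi) Real.pi, w 1 (x, z) := by
    filter_upwards [S.slice_integrable w Real.pi, S.slice_integrable w (-Real.pi)] with z h1 h2
    rw [traceX, traceX, ← mul_sub, ← integral_sub h1 h2]
    have : ∀ x : ℝ, (w 0 (x, z) + ((x + Real.pi : ℝ) : ℂ) * w 1 (x, z)
        - (w 0 (x, z) + ((x + -Real.pi : ℝ) : ℂ) * w 1 (x, z)))
        = ((2 * Real.pi : ℝ) : ℂ) * w 1 (x, z) := by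
      intro x; push_cast; ring
    simp only [this]
    rw [integral_const_mul, ← mul_assoc, ← Complex.ofReal_mul,
      one_div_mul_cancel (by positivity)]
    simp
  constructor
  · intro h
    filter_upwards [h, key] with z h1 h2
    rw [← h2, h1, sub_self]; rfl
  · intro h
    filter_upwards [h, key] with z h1 h2
    rw [← sub_eq_zero, h2, h1]; rfl

theorem integrable_mul_continuous (f : S.L2) {g : ℝ × ℝ → ℂ} (hg : Continuous g) :
    Integrable (fun q => f q * g q) S.vol := by
  obtain ⟨C, hC⟩ := S.exists_bound_Omega hg
  refine (S.integrable_L2 f).mul_bdd (c := C) hg.aestronglyMeasurable ?_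
  filter_upwards [S.ae_mem_Omega] with q hq using hC q hq

theorem integral_vol_eq_dx_dz {g : ℝ × ℝ → ℂ} (hg : Integrable g S.vol) :
    ∫ q, g q ∂S.vol
      = ∫ z in Ioo (-S.L) S.L, ∫ x in Ioo (-Real.pi) Real.pi, g (x, z) := by
  rw [vol_eq] at hg ⊢
  exact integral_prod_symm _ hg

theorem integral_vol_eq_dz_dx {g : ℝ × ℝ → ℂ} (hg : Integrable g S.vol) :
    ∫ q, g q ∂S.vol
      = ∫ x in Ioo (-Real.pi) Real.pi, ∫ z in Ioo (-S.L) S.L, g (x, z) := by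
  rw [vol_eq] at hg ⊢
  exact integral_prod _ hg

theorem integral_dx_mul_eq_zero {w : S.Triple}
    (h : S.traceX Real.pi w =ᵐ[volume.restrict (Ioo (-S.L) S.L)] S.traceX (-Real.pi) w)
    {b : ℝ → ℂ} (hb : Continuous b) : ∫ q, w 1 q * b q.2 ∂S.vol = 0 := by
  have hi := S.integrable_mul_continuous (w 1) (g := fun q => b q.2) (by fun_prop)
  have := (S.traceX_eq_iff w).1 h
  rw [S.integral_vol_eq_dx_dz hi, integral_eq_zero_of_ae]
  filter_upwards [this] with z hz
  rw [integral_mul_const, hz]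
  simp

theorem contDiff_exp_int (m : ℤ) :
    ContDiff ℝ ∞ fun x : ℝ => Complex.exp (-(Complex.I * m * x)) := by
  have : ContDiff ℝ ∞ (fun x : ℝ => (x : ℂ)) := Complex.ofRealCLM.contDiff
  fun_prop

theorem contDiff_ramp_pow (c : ℝ) (k : ℕ) :
    ContDiff ℝ ∞ fun z : ℝ => ((((z + c) / (2 * c)) ^ k : ℝ) : ℂ) :=
  Complex.ofRealCLM.contDiff.comp (by fun_prop : ContDiff ℝ ∞ fun z : ℝ => ((z + c) / (2 * c)) ^ k)

/-- On periodic functions, `∂ₓ` acts on the modes as multiplication by `im`. -/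
theorem inner_mode_dx {w : S.Triple} (hw : w ∈ S.H1per) (c : ℝ) (m : ℤ) (k : ℕ) :
    inner ℂ (S.mode c m k) (w 1) = Complex.I * m * inner ℂ (S.mode c m k) (w 0) := by
  set γ : ℂ := Complex.exp (-(Complex.I * m * Real.pi)) with hγ
  have hγ' : Complex.exp (-(Complex.I * m * ((-Real.pi : ℝ) : ℂ))) = γ := by
    rw [hγ, Complex.exp_eq_exp_iff_exists_int]
    exact ⟨m, by push_cast; ring⟩
  have hd : ∀ x : ℝ, deriv (fun x : ℝ => Complex.exp (-(Complex.I * m * x)) - γ) x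
      = -(Complex.I * m) * Complex.exp (-(Complex.I * m * x)) := by
    intro x
    have h1 : HasDerivAt (fun x : ℝ => -(Complex.I * m * (x : ℂ))) (-(Complex.I * m)) x := by
      simpa using! ((hasDerivAt_id x).ofReal_comp.const_mul (Complex.I * m)).neg
    rw [(h1.cexp.sub_const γ).deriv]
    ring
  have h := hw.1.integral_mul_x S ((contDiff_exp_int m).sub (contDiff_const (c := γ)))
    (contDiff_ramp_pow c k) (by rw [hγ, sub_self]) (by rw [hγ', sub_self])
  simp only [hd] at h
  have hz := S.integral_dx_mul_eq_zero hw.2.2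
    (b := fun z => γ * ((((z + c) / (2 * c)) ^ k : ℝ) : ℂ)) (by fun_prop)
  have e1 : ∀ q : ℝ × ℝ, w 0 q * (-(Complex.I * m) * Complex.exp (-(Complex.I * m * q.1))
      * ((((q.2 + c) / (2 * c)) ^ k : ℝ) : ℂ)) = -(Complex.I * m) * (w 0 q *
      (Complex.exp (-(Complex.I * m * q.1)) * ((((q.2 + c) / (2 * c)) ^ k : ℝ) : ℂ))) := by
    intro q; ring
  have e2 : ∀ q : ℝ × ℝ, w 1 q * ((Complex.exp (-(Complex.I * m * q.1)) - γ)
      * ((((q.2 + c) / (2 * c)) ^ k : ℝ) : ℂ)) = w 1 q *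
      (Complex.exp (-(Complex.I * m * q.1)) * ((((q.2 + c) / (2 * c)) ^ k : ℝ) : ℂ))
      - w 1 q * (γ * ((((q.2 + c) / (2 * c)) ^ k : ℝ) : ℂ)) := by
    intro q; ring
  simp only [e1, e2] at h
  rw [integral_sub (S.integrable_mul_continuous _ (by fun_prop))
    (S.integrable_mul_continuous _ (by fun_prop)), hz, sub_zero, integral_const_mul,
    ← S.inner_mode, ← S.inner_mode] at h
  linear_combination h

/-! ### The trace inequality -/

/-- The Fourier coefficients of the trace on the side `z = c`, `c = ±L`. -/
noncomputable def traceCoeff (c : ℝ) (w : S.Triple) (m : ℤ) : ℂ :=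
  (1 / (2 * Real.pi) : ℝ) * ∫ x in Ioo (-Real.pi) Real.pi,
    S.traceZ c w x * Complex.exp (-(Complex.I * m * x))

theorem traceCoeff_eq {c : ℝ} (hc : c = S.L ∨ c = -S.L) (w : S.Triple) (m : ℤ) :
    S.traceCoeff c w m = (1 / (2 * Real.pi) : ℝ) *
      ((1 / (2 * S.L) : ℝ) * inner ℂ (S.mode c m 0) (w 0)
        + (c / S.L : ℝ) * inner ℂ (S.mode c m 1) (w 2)) := by
  have hL := S.L_pos
  have hc0 : c ≠ 0 := by rcases hc with rfl | rfl <;> simp [hL.ne']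
  have i0 := S.integrable_mul_continuous (w 0)
    (g := fun q => Complex.exp (-(Complex.I * m * q.1))) (by fun_prop)
  have i2 := S.integrable_mul_continuous (w 2)
    (g := fun q => ((q.2 + c : ℝ) : ℂ) * Complex.exp (-(Complex.I * m * q.1))) (by fun_prop)
  have hi : Integrable (fun q : ℝ × ℝ => (w 0 q + ((q.2 + c : ℝ) : ℂ) * w 2 q)
      * Complex.exp (-(Complex.I * m * q.1))) S.vol := by
    refine (i0.add i2).congr (ae_of_all _ fun q => ?_)
    simp only [Pi.add_apply]; ring
  have e0 : ∫ x in Ioo (-Real.pi) Real.pi, S.traceZ c w x * Complex.exp (-(Complex.I * m * x))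
      = (1 / (2 * S.L) : ℝ) * ∫ q, (w 0 q + ((q.2 + c : ℝ) : ℂ) * w 2 q)
      * Complex.exp (-(Complex.I * m * q.1)) ∂S.vol := by
    rw [S.integral_vol_eq_dz_dx hi, ← integral_const_mul]
    refine integral_congr_ae (ae_of_all _ fun x => ?_)
    simp only [traceZ]
    rw [integral_mul_const, mul_assoc]
  have e1 : ∀ q : ℝ × ℝ, (w 0 q + ((q.2 + c : ℝ) : ℂ) * w 2 q)
      * Complex.exp (-(Complex.I * m * q.1)) =
      w 0 q * (Complex.exp (-(Complex.I * m * q.1)) * ((((q.2 + c) / (2 * c)) ^ 0 : ℝ) : ℂ))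
      + 2 * c * (w 2 q * (Complex.exp (-(Complex.I * m * q.1))
        * ((((q.2 + c) / (2 * c)) ^ 1 : ℝ) : ℂ))) := by
    intro q
    have : (c : ℂ) ≠ 0 := by exact_mod_cast hc0
    push_cast
    field_simp
  rw [traceCoeff, e0]
  simp only [e1]
  rw [integral_add (S.integrable_mul_continuous _ (by fun_prop))
    ((S.integrable_mul_continuous _ (by fun_prop)).const_mul _), integral_const_mul,
    ← S.inner_mode, ← S.inner_mode]
  have : (S.L : ℂ) ≠ 0 := by exact_mod_cast hL.ne'
  push_cast
  field_simp

/-- The ramp in the formula for the trace may be replaced by its powers: their difference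
vanishes on both horizontal sides. -/
theorem traceCoeff_eq_pow {c : ℝ} (hc : c = S.L ∨ c = -S.L) {w : S.Triple} (hw : w ∈ S.H1per)
    (m : ℤ) {k : ℕ} (hk : k ≠ 0) :
    S.traceCoeff c w m = (1 / (2 * Real.pi) : ℝ) *
      ((1 / (2 * S.L) : ℝ) * (k * inner ℂ (S.mode c m (k - 1)) (w 0))
        + (c / S.L : ℝ) * inner ℂ (S.mode c m k) (w 2)) := by
  have hL := S.L_pos
  have hc0 : c ≠ 0 := by rcases hc with rfl | rfl <;> simp [hL.ne']
  have hcC : (c : ℂ) ≠ 0 := by exact_mod_cast hc0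
  have hd : ∀ z : ℝ, deriv (fun z : ℝ => ((((z + c) / (2 * c)) ^ k : ℝ) : ℂ)
      - ((((z + c) / (2 * c)) ^ 1 : ℝ) : ℂ)) z
      = ((k * ((z + c) / (2 * c)) ^ (k - 1) - 1) / (2 * c) : ℝ) := by
    intro z
    have h1 : HasDerivAt (fun z : ℝ => (z + c) / (2 * c)) (1 / (2 * c)) z :=
      ((hasDerivAt_id z).add_const c).div_const _
    have h2 := ((h1.pow k).ofReal_comp).sub ((h1.pow 1).ofReal_comp)
    refine h2.deriv.trans ?_
    rw [← Complex.ofReal_sub]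
    congr 1
    simp
    field_simp
  have v : ∀ t : ℝ, t = 0 ∨ t = 1 → ((t ^ k : ℝ) : ℂ) - ((t ^ 1 : ℝ) : ℂ) = 0 := by
    rintro t (rfl | rfl) <;> simp [hk]
  have hb1 : (S.L + c) / (2 * c) = 0 ∨ (S.L + c) / (2 * c) = 1 := by
    rcases hc with rfl | rfl
    · right; field_simp; ring
    · left; simp
  have hb2 : (-S.L + c) / (2 * c) = 0 ∨ (-S.L + c) / (2 * c) = 1 := by
    rcases hc with rfl | rfl
    · left; simp
    · right; field_simp; ring
  have h := hw.2.1.integral_mul_z S (contDiff_exp_int m)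
    ((contDiff_ramp_pow c k).sub (contDiff_ramp_pow c 1)) (v _ hb1) (v _ hb2)
  simp only [hd] at h
  have e1 : ∀ q : ℝ × ℝ, w 0 q * (Complex.exp (-(Complex.I * m * q.1))
      * ((k * ((q.2 + c) / (2 * c)) ^ (k - 1) - 1) / (2 * c) : ℝ))
      = 1 / (2 * c) * (k * (w 0 q * (Complex.exp (-(Complex.I * m * q.1))
        * ((((q.2 + c) / (2 * c)) ^ (k - 1) : ℝ) : ℂ)))
        - w 0 q * (Complex.exp (-(Complex.I * m * q.1))
        * ((((q.2 + c) / (2 * c)) ^ 0 : ℝ) : ℂ))) := by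
    intro q
    push_cast
    field_simp
  have e2 : ∀ q : ℝ × ℝ, w 2 q * (Complex.exp (-(Complex.I * m * q.1))
      * (((((q.2 + c) / (2 * c)) ^ k : ℝ) : ℂ) - ((((q.2 + c) / (2 * c)) ^ 1 : ℝ) : ℂ)))
      = w 2 q * (Complex.exp (-(Complex.I * m * q.1)) * ((((q.2 + c) / (2 * c)) ^ k : ℝ) : ℂ))
      - w 2 q * (Complex.exp (-(Complex.I * m * q.1)) * ((((q.2 + c) / (2 * c)) ^ 1 : ℝ) : ℂ)) := by
    intro q; ring
  simp only [e1, e2] at h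
  rw [integral_sub (S.integrable_mul_continuous _ (by fun_prop))
    (S.integrable_mul_continuous _ (by fun_prop)), integral_const_mul,
    integral_sub ((S.integrable_mul_continuous _ (by fun_prop)).const_mul _)
    (S.integrable_mul_continuous _ (by fun_prop)), integral_const_mul,
    ← S.inner_mode, ← S.inner_mode, ← S.inner_mode, ← S.inner_mode] at h
  rw [S.traceCoeff_eq hc]
  congr 1
  have hLC : (S.L : ℂ) ≠ 0 := by exact_mod_cast hL.ne'
  push_cast
  field_simp at h ⊢
  linear_combination -h

/-- The weight `max(1, |m|)` of the `H^{1/2}` norm. -/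
def freq (m : ℤ) : ℕ := max 1 m.natAbs

theorem freq_pos (m : ℤ) : 0 < freq m := by unfold freq; positivity

/-- A factor `m` costs one derivative in `x`; the term with `w 0` is needed for `m = 0` only. -/
theorem freq_mul_norm_inner_le {w : S.Triple} (hw : w ∈ S.H1per) (c : ℝ) (m : ℤ) (k : ℕ) :
    freq m * ‖inner ℂ (S.mode c m k) (w 0)‖
      ≤ ‖inner ℂ (S.mode c m k) (w 0)‖ + ‖inner ℂ (S.mode c m k) (w 1)‖ := by
  rw [S.inner_mode_dx hw, norm_mul, norm_mul, Complex.norm_I, one_mul, Complex.norm_intCast,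
    ← one_add_mul]
  gcongr
  rw [freq, Nat.cast_max, Nat.cast_natAbs, Nat.cast_one, Int.cast_abs]
  exact max_le_add_of_nonneg zero_le_one (abs_nonneg _)

theorem sum_freq_inner_mode_le {c : ℝ} (hc : c = S.L ∨ c = -S.L) (k : ℤ → ℕ)
    (hk : ∀ m, freq m ≤ k m + 1) (f : S.L2) (s : Finset ℤ) :
    ∑ m ∈ s, (freq m : ℝ) * ‖inner ℂ (S.mode c m (k m)) f‖ ^ 2
      ≤ 4 * Real.pi * S.L * ‖f‖ ^ 2 := by
  refine sum_mul_norm_inner_sq_le (fun m n h => S.inner_mode_of_ne hc h _ _)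
    (fun m => Nat.cast_nonneg _) (by have := S.L_pos; positivity) (fun m => ?_) f s
  have hL := S.L_pos
  rw [S.norm_mode_sq hc]
  have h1 : (freq m : ℝ) ≤ k m + 1 := by exact_mod_cast hk m
  have h2 : (freq m : ℝ) / (2 * k m + 1) ≤ 1 := by
    rw [div_le_one (by positivity)]
    have : (0 : ℝ) ≤ k m := by positivity
    linarith
  calc (freq m : ℝ) * (2 * Real.pi * (2 * S.L / (2 * k m + 1)))
      = (freq m : ℝ) / (2 * k m + 1) * (4 * Real.pi * S.L) := by ring
    _ ≤ 1 * (4 * Real.pi * S.L) := by gcongr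
    _ = _ := one_mul _

/-- The trace inequality from `H¹_per(Ω)` to `H^{1/2}` of a horizontal side. The power of the ramp
is adapted to the frequency, so that the mode of frequency `m` is concentrated in a layer of
thickness `1 / |m|`; the modes are orthogonal, and Bessel's inequality sums the estimates. -/
theorem exists_traceCoeff_bound : ∃ C : ℝ, 0 ≤ C ∧ ∀ c : ℝ, (c = S.L ∨ c = -S.L) →
    ∀ w ∈ S.H1per, ∀ s : Finset ℤ,
      ∑ m ∈ s, (freq m : ℝ) * ‖S.traceCoeff c w m‖ ^ 2 ≤ C * ‖w‖ ^ 2 := by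
  have hL := S.L_pos
  set a : ℝ := 1 / (2 * Real.pi) with ha
  set b : ℝ := 1 / (2 * S.L) with hb
  have ha0 : 0 < a := by have := Real.pi_pos; positivity
  have hb0 : 0 < b := by positivity
  refine ⟨a ^ 2 * (3 * (b ^ 2 + 1)) * (4 * Real.pi * S.L), by positivity, fun c hc w hw s => ?_⟩
  have habs : |c / S.L| = 1 := by
    rcases hc with rfl | rfl
    · rw [div_self hL.ne', abs_one]
    · rw [neg_div, div_self hL.ne', abs_neg, abs_one]
  have hpt : ∀ m, ‖S.traceCoeff c w m‖ ^ 2 ≤ a ^ 2 * (3 * (b ^ 2 + 1)) *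
      (‖inner ℂ (S.mode c m (freq m - 1)) (w 0)‖ ^ 2
        + ‖inner ℂ (S.mode c m (freq m - 1)) (w 1)‖ ^ 2
        + ‖inner ℂ (S.mode c m (freq m)) (w 2)‖ ^ 2) := by
    intro m
    set X := ‖inner ℂ (S.mode c m (freq m - 1)) (w 0)‖ with hX
    set Y := ‖inner ℂ (S.mode c m (freq m - 1)) (w 1)‖ with hY
    set Z := ‖inner ℂ (S.mode c m (freq m)) (w 2)‖ with hZ
    have h1 : ‖S.traceCoeff c w m‖ ≤ a * (b * (X + Y) + Z) := by
      rw [S.traceCoeff_eq_pow hc hw m (freq_pos m).ne', ← ha, ← hb, norm_mul, Complex.norm_real,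
        Real.norm_eq_abs, abs_of_pos ha0]
      gcongr
      refine (norm_add_le _ _).trans ?_
      rw [norm_mul, norm_mul, norm_mul, Complex.norm_real, Complex.norm_real, Real.norm_eq_abs,
        Real.norm_eq_abs, habs, one_mul, abs_of_pos hb0, Complex.norm_natCast]
      gcongr
      exact S.freq_mul_norm_inner_le hw c m _
    have hX0 : 0 ≤ X := norm_nonneg _
    have hY0 : 0 ≤ Y := norm_nonneg _
    have hZ0 : 0 ≤ Z := norm_nonneg _
    calc ‖S.traceCoeff c w m‖ ^ 2 ≤ (a * (b * (X + Y) + Z)) ^ 2 := by gcongr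
      _ = a ^ 2 * (b * X + b * Y + Z) ^ 2 := by ring
      _ ≤ a ^ 2 * (3 * ((b * X) ^ 2 + (b * Y) ^ 2 + Z ^ 2)) := by
          gcongr
          nlinarith [sq_nonneg (b * X - b * Y), sq_nonneg (b * X - Z), sq_nonneg (b * Y - Z)]
      _ ≤ _ := by
          rw [mul_assoc, mul_assoc]
          gcongr a ^ 2 * ?_
          nlinarith [sq_nonneg X, sq_nonneg Y, mul_nonneg (sq_nonneg b) (sq_nonneg Z)]
  have hn : ‖w‖ ^ 2 = ‖w 0‖ ^ 2 + ‖w 1‖ ^ 2 + ‖w 2‖ ^ 2 := by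
    rw [PiLp.norm_sq_eq_of_L2, Fin.sum_univ_three]
  have b0 := S.sum_freq_inner_mode_le hc (fun m => freq m - 1) (fun m => by omega) (w 0) s
  have b1 := S.sum_freq_inner_mode_le hc (fun m => freq m - 1) (fun m => by omega) (w 1) s
  have b2 := S.sum_freq_inner_mode_le hc (fun m => freq m) (fun m => by omega) (w 2) s
  calc _ ≤ ∑ m ∈ s, a ^ 2 * (3 * (b ^ 2 + 1)) *
      ((freq m : ℝ) * ‖inner ℂ (S.mode c m (freq m - 1)) (w 0)‖ ^ 2
        + (freq m : ℝ) * ‖inner ℂ (S.mode c m (freq m - 1)) (w 1)‖ ^ 2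
        + (freq m : ℝ) * ‖inner ℂ (S.mode c m (freq m)) (w 2)‖ ^ 2) := by
        refine Finset.sum_le_sum fun m _ => ?_
        refine (mul_le_mul_of_nonneg_left (hpt m) (Nat.cast_nonneg _)).trans (le_of_eq ?_)
        ring
    _ ≤ _ := by
        rw [← Finset.mul_sum, Finset.sum_add_distrib, Finset.sum_add_distrib, hn,
          mul_assoc _ (4 * _ * _)]
        gcongr
        linarith

/-! ### Completeness of the periodic Sobolev space -/

theorem continuous_integral_mul {g : ℝ × ℝ → ℂ} (hg : Continuous g) :
    Continuous fun f : S.L2 => ∫ q, f q * g q ∂S.vol := by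
  have h := S.memLp_of_continuous (Complex.continuous_conj.comp hg)
  have : (fun f : S.L2 => ∫ q, f q * g q ∂S.vol) = fun f => inner ℂ h.toLp f := by
    ext f
    rw [L2.inner_def]
    refine integral_congr_ae ?_
    filter_upwards [h.coeFn_toLp] with q hq
    rw [hq, RCLike.inner_apply]
    simp
  rw [this]
  fun_prop

/-- Periodicity, expressed through test functions of `z`. -/
theorem traceX_eq_iff_forall_integral (w : S.Triple) :
    S.traceX Real.pi w =ᵐ[volume.restrict (Ioo (-S.L) S.L)] S.traceX (-Real.pi) w ↔
    ∀ b : ℝ → ℝ, Continuous b → ∫ q, w 1 q * (b q.2 : ℂ) ∂S.vol = 0 := by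
  refine ⟨fun h b hb => S.integral_dx_mul_eq_zero h (b := fun z => (b z : ℂ)) (by fun_prop),
    fun h => (S.traceX_eq_iff w).2 ?_⟩
  have hint : Integrable (fun z => ∫ x in Ioo (-Real.pi) Real.pi, w 1 (x, z))
      (volume.restrict (Ioo (-S.L) S.L)) := by
    have key : ∀ g : ℝ × ℝ → ℂ, Integrable g S.vol →
        Integrable (fun z => ∫ x in Ioo (-Real.pi) Real.pi, g (x, z))
          (volume.restrict (Ioo (-S.L) S.L)) := by
      intro g hg
      rw [vol_eq] at hg
      exact hg.integral_prod_right
    exact key _ (S.integrable_L2 (w 1))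
  refine ae_eq_zero_of_integral_contDiff_smul_eq_zero hint.locallyIntegrable fun b hb _ => ?_
  rw [← h b hb.continuous, S.integral_vol_eq_dx_dz
    (S.integrable_mul_continuous (w 1) (g := fun q => (b q.2 : ℂ))
      (by have := hb.continuous; fun_prop))]
  refine integral_congr_ae (ae_of_all _ fun z => ?_)
  simp only
  rw [integral_mul_const, mul_comm, Complex.real_smul]

theorem isClosed_setOf_isWeakDeriv (e : ℝ × ℝ) (i : Fin 3) :
    IsClosed {w : S.Triple | S.IsWeakDeriv e (w 0) (w i)} := by
  have hc : ∀ i, Continuous fun w : S.Triple => w i := fun i => by fun_prop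
  simp only [IsWeakDeriv, ofPred_forall]
  refine isClosed_iInter fun φ => isClosed_iInter fun hφ => isClosed_eq ?_ ?_
  · exact (S.continuous_integral_mul (hφ.deriv_prop S e).1).comp (hc 0)
  · exact ((S.continuous_integral_mul hφ.1.continuous).comp (hc i)).neg

theorem isClosed_H1per : IsClosed (S.H1per : Set S.Triple) := by
  have h3 : IsClosed {w : S.Triple |
      S.traceX Real.pi w =ᵐ[volume.restrict (Ioo (-S.L) S.L)] S.traceX (-Real.pi) w} := by
    simp only [S.traceX_eq_iff_forall_integral, ofPred_forall]
    refine isClosed_iInter fun b => isClosed_iInter fun hb => isClosed_eq ?_ continuous_const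
    exact (S.continuous_integral_mul (g := fun q => (b q.2 : ℂ)) (by fun_prop)).comp
      (by fun_prop : Continuous fun w : S.Triple => w 1)
  exact (S.isClosed_setOf_isWeakDeriv _ 1).inter ((S.isClosed_setOf_isWeakDeriv _ 2).inter h3)

instance : CompleteSpace S.H1per := S.isClosed_H1per.completeSpace_coe

/-! ### Operators of the volume forms -/

theorem inner_add_clm (T T' : S.H1per →L[ℂ] S.H1per) (u v : S.H1per) :
    inner ℂ v ((T + T') u) = inner ℂ v (T u) + inner ℂ v (T' u) :=
  inner_add_right _ _ _

theorem inner_sub_clm (T T' : S.H1per →L[ℂ] S.H1per) (u v : S.H1per) :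
    inner ℂ v ((T - T') u) = inner ℂ v (T u) - inner ℂ v (T' u) :=
  inner_sub_right _ _ _

theorem inner_smul_clm (a : ℂ) (T : S.H1per →L[ℂ] S.H1per) (u v : S.H1per) :
    inner ℂ v ((a • T) u) = a * inner ℂ v (T u) := by
  change inner ℂ v (a • T u) = _
  exact inner_smul_right v (T u) a

theorem integrable_mul_conj {a : ℝ × ℝ → ℝ} (ha : Measurable a) {C : ℝ} (hC : ∀ q, |a q| ≤ C)
    (f g : S.L2) : Integrable (fun q => (a q : ℂ) * (f q * conj (g q))) S.vol := by
  refine Integrable.bdd_mul (c := C) ?_ (by fun_prop) (ae_of_all _ fun q => ?_)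
  · exact L2.integrable_inner (𝕜 := ℂ) g f
  · simpa using hC q

/-- Multiplication by a bounded measurable function on `L²(Ω)`. -/
theorem exists_mul_clm {a : ℝ × ℝ → ℝ} (ha : Measurable a) {C : ℝ} (hC : ∀ q, |a q| ≤ C) :
    ∃ T : S.L2 →L[ℂ] S.L2, ∀ f g, inner ℂ g (T f) = ∫ q, (a q : ℂ) * (f q * conj (g q)) ∂S.vol := by
  have hm : ∀ f : S.L2, MemLp (fun q => (a q : ℂ) * f q) 2 S.vol := fun f => by
    refine (Lp.memLp f).of_le_mul (c := C)
      ((by fun_prop : AEStronglyMeasurable (fun q => (a q : ℂ)) S.vol).mul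
        (Lp.aestronglyMeasurable f)) (ae_of_all _ fun q => ?_)
    rw [norm_mul, Complex.norm_real]
    gcongr
    exact hC q
  let T : S.L2 →ₗ[ℂ] S.L2 :=
    { toFun := fun f => (hm f).toLp
      map_add' := fun f g => by
        refine Lp.ext ?_
        filter_upwards [(hm (f + g)).coeFn_toLp, Lp.coeFn_add ((hm f).toLp : S.L2) (hm g).toLp,
          (hm f).coeFn_toLp, (hm g).coeFn_toLp, Lp.coeFn_add f g] with q h1 h2 h3 h4 h5
        rw [h1, h2, Pi.add_apply, h3, h4, h5, Pi.add_apply, mul_add]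
      map_smul' := fun c f => by
        refine Lp.ext ?_
        filter_upwards [(hm (c • f)).coeFn_toLp, Lp.coeFn_smul c ((hm f).toLp : S.L2),
          (hm f).coeFn_toLp, Lp.coeFn_smul c f] with q h1 h2 h3 h4
        rw [h1, RingHom.id_apply, h2, Pi.smul_apply, h3, h4, Pi.smul_apply, smul_eq_mul,
          smul_eq_mul]
        ring }
  refine ⟨T.mkContinuous C fun f => ?_, fun f g => ?_⟩
  · refine Lp.norm_le_mul_norm_of_ae_le_mul ?_
    filter_upwards [(hm f).coeFn_toLp] with q hq
    change ‖((hm f).toLp : S.L2) q‖ ≤ _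
    rw [hq, norm_mul, Complex.norm_real]
    gcongr
    exact hC q
  · rw [L2.inner_def]
    refine integral_congr_ae ?_
    filter_upwards [(hm f).coeFn_toLp] with q hq
    change inner ℂ (g q) (((hm f).toLp : S.L2) q) = _
    rw [hq, RCLike.inner_apply, mul_assoc]

/-- The components `u`, `∂ₓu`, `∂_z u` as operators from `H¹_per(Ω)` to `L²(Ω)`. -/
noncomputable def component (i : Fin 3) : S.H1per →L[ℂ] S.L2 :=
  (PiLp.proj 2 (fun _ : Fin 3 => S.L2) i).comp S.H1per.subtypeL

theorem exists_form_clm {a : ℝ × ℝ → ℝ} (ha : Measurable a) {C : ℝ} (hC : ∀ q, |a q| ≤ C)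
    (i j : Fin 3) : ∃ T : S.H1per →L[ℂ] S.H1per, ∀ u v : S.H1per,
      inner ℂ v (T u) = ∫ q, (a q : ℂ) * (u.1 i q * conj (v.1 j q)) ∂S.vol := by
  obtain ⟨M, hM⟩ := S.exists_mul_clm ha hC
  refine ⟨(S.component j).adjoint ∘L M ∘L S.component i, fun u v => ?_⟩
  simp only [ContinuousLinearMap.comp_apply]
  rw [ContinuousLinearMap.adjoint_inner_right, hM]
  rfl

theorem eps_abs_bound : ∃ C, ∀ q, |S.eps q| ≤ C := by
  obtain ⟨a, b, ha, h⟩ := S.eps_bounds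
  exact ⟨b, fun q => abs_le.2 ⟨by linarith [(h q).1, (h q).2], (h q).2.le⟩⟩

theorem mu_inv_abs_bound : ∃ C, ∀ q, |(S.mu q)⁻¹| ≤ C := by
  obtain ⟨a, b, ha, h⟩ := S.mu_bounds
  refine ⟨a⁻¹, fun q => ?_⟩
  rw [abs_of_pos (inv_pos.2 (ha.trans (h q).1))]
  exact inv_anti₀ ha (h q).1.le

theorem eps0_pos : 0 < S.eps0 := by
  obtain ⟨a, b, ha, h⟩ := S.eps_bounds
  rw [← S.eps_ambient 0 S.L (le_abs_self _)]
  exact ha.trans (h _).1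

theorem mu0_pos : 0 < S.mu0 := by
  obtain ⟨a, b, ha, h⟩ := S.mu_bounds
  rw [← S.mu_ambient 0 S.L (le_abs_self _)]
  exact ha.trans (h _).1

theorem exists_represents_b : ∃ B : S.H1per →L[ℂ] S.H1per, S.Represents B S.b := by
  obtain ⟨C, hC⟩ := S.eps_abs_bound
  exact S.exists_form_clm S.eps_measurable hC 0 0

theorem integral_add_smul_four {α : Type*} [MeasurableSpace α] {ν : Measure α}
    {f₁ f₂ f₃ f₄ f₅ : α → ℂ} (h₁ : Integrable f₁ ν) (h₂ : Integrable f₂ ν) (h₃ : Integrable f₃ ν)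
    (h₄ : Integrable f₄ ν) (h₅ : Integrable f₅ ν) {a b c : ℂ} :
    ∫ q, (f₁ q + f₂ q + a * f₃ q + b * f₄ q + c * f₅ q) ∂ν
      = ∫ q, f₁ q ∂ν + ∫ q, f₂ q ∂ν + a * ∫ q, f₃ q ∂ν + b * ∫ q, f₄ q ∂ν + c * ∫ q, f₅ q ∂ν := by
  have i₂ : Integrable (fun q => f₁ q + f₂ q) ν := h₁.add h₂
  have i₃ : Integrable (fun q => f₁ q + f₂ q + a * f₃ q) ν := i₂.add (h₃.const_mul a)
  have i₄ : Integrable (fun q => f₁ q + f₂ q + a * f₃ q + b * f₄ q) ν := i₃.add (h₄.const_mul b)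
  rw [integral_add i₄ (h₅.const_mul c), integral_add i₃ (h₄.const_mul b),
    integral_add i₂ (h₃.const_mul a), integral_add h₁ h₂, integral_const_mul, integral_const_mul,
    integral_const_mul]

/-- The volume part of `h` depends on `k` through a quadratic polynomial of operators. -/
theorem exists_volume_clm : ∃ T₀ T₁ T₂ : S.H1per →L[ℂ] S.H1per, ∀ (k : ℂ) (u v : S.H1per),
    inner ℂ v ((T₀ + k • T₁ + k ^ 2 • T₂) u) = ∫ q, ((S.mu q)⁻¹ : ℂ) *
      ((u.1 1 q + Complex.I * k * u.1 0 q) * (conj (v.1 1 q) - Complex.I * k * conj (v.1 0 q))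
        + u.1 2 q * conj (v.1 2 q)) ∂S.vol := by
  obtain ⟨C, hC⟩ := S.mu_inv_abs_bound
  have hm : Measurable fun q => (S.mu q)⁻¹ := S.mu_measurable.inv
  have hi := fun (u v : S.H1per) (i j : Fin 3) => S.integrable_mul_conj hm hC (u.1 i) (v.1 j)
  choose G hG using S.exists_form_clm hm hC
  refine ⟨G 1 1 + G 2 2, Complex.I • (G 0 1 - G 1 0), G 0 0, fun k u v => ?_⟩
  have e : ∀ q, ((S.mu q)⁻¹ : ℂ) *
      ((u.1 1 q + Complex.I * k * u.1 0 q) * (conj (v.1 1 q) - Complex.I * k * conj (v.1 0 q))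
        + u.1 2 q * conj (v.1 2 q))
      = (((S.mu q)⁻¹ : ℝ) : ℂ) * (u.1 1 q * conj (v.1 1 q))
        + (((S.mu q)⁻¹ : ℝ) : ℂ) * (u.1 2 q * conj (v.1 2 q))
        + Complex.I * k * ((((S.mu q)⁻¹ : ℝ) : ℂ) * (u.1 0 q * conj (v.1 1 q)))
        + -(Complex.I * k) * ((((S.mu q)⁻¹ : ℝ) : ℂ) * (u.1 1 q * conj (v.1 0 q)))
        + k ^ 2 * ((((S.mu q)⁻¹ : ℝ) : ℂ) * (u.1 0 q * conj (v.1 0 q))) := by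
    intro q
    push_cast
    linear_combination -((S.mu q : ℂ)⁻¹ * k ^ 2 * u.1 0 q * conj (v.1 0 q)) * Complex.I_sq
  simp only [e]
  rw [integral_add_smul_four (hi u v 1 1) (hi u v 2 2) (hi u v 0 1) (hi u v 1 0) (hi u v 0 0),
    ← hG, ← hG, ← hG, ← hG, ← hG]
  simp only [inner_add_clm, inner_smul_clm, inner_sub_clm]
  ring

end Slab

/-! ### The operator of the boundary form -/

/-- Bounded sequences act on `ℓ²` by multiplication. -/
theorem exists_diagonal_clm :
    ∃ D : (ℤ →ᵇ ℂ) →L[ℂ] lp (fun _ : ℤ => ℂ) 2 →L[ℂ] lp (fun _ : ℤ => ℂ) 2,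
    ∀ (d : ℤ →ᵇ ℂ) (f : lp (fun _ : ℤ => ℂ) 2) (m : ℤ), D d f m = d m * f m := by
  have hm : ∀ (d : ℤ →ᵇ ℂ) (f : lp (fun _ : ℤ => ℂ) 2), Memℓp (fun m => d m * f m) 2 := by
    intro d f
    refine (lp.memℓp ((‖d‖ : ℂ) • f)).mono' fun m => ?_
    rw [norm_mul, lp.coeFn_smul, Pi.smul_apply, norm_smul, Complex.norm_real, norm_norm]
    gcongr
    exact d.norm_coe_le_norm m
  let D := LinearMap.mk₂ ℂ (fun (d : ℤ →ᵇ ℂ) (f : lp (fun _ : ℤ => ℂ) 2) =>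
      (⟨fun m => d m * f m, hm d f⟩ : lp (fun _ : ℤ => ℂ) 2))
    (fun d d' f => by ext m; exact add_mul _ _ _)
    (fun c d f => by ext m; simp [mul_assoc])
    (fun d f f' => by ext m; exact mul_add _ _ _)
    (fun c d f => by ext m; simp; ring)
  refine ⟨D.mkContinuous₂ 1 fun d f => ?_, fun d f m => rfl⟩
  have : ‖D d f‖ ≤ ‖(‖d‖ : ℂ) • f‖ := by
    refine lp.norm_mono two_ne_zero fun m => ?_
    change ‖d m * f m‖ ≤ _
    rw [norm_mul, lp.coeFn_smul, Pi.smul_apply, norm_smul, Complex.norm_real, norm_norm]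
    gcongr
    exact d.norm_coe_le_norm m
  rw [norm_smul, Complex.norm_real, norm_norm] at this
  rwa [one_mul]

namespace Slab

variable (S : Slab)

theorem traceCoeff_add {c : ℝ} (hc : c = S.L ∨ c = -S.L) (w w' : S.Triple) (m : ℤ) :
    S.traceCoeff c (w + w') m = S.traceCoeff c w m + S.traceCoeff c w' m := by
  simp only [S.traceCoeff_eq hc, PiLp.add_apply, inner_add_right]
  ring

theorem traceCoeff_smul {c : ℝ} (hc : c = S.L ∨ c = -S.L) (a : ℂ) (w : S.Triple) (m : ℤ) :
    S.traceCoeff c (a • w) m = a * S.traceCoeff c w m := by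
  simp only [S.traceCoeff_eq hc, PiLp.smul_apply, inner_smul_right]
  ring

/-- The trace on a horizontal side, from `H¹_per(Ω)` to the space `H^{1/2}`, realized as `ℓ²` by
weighting the Fourier coefficients. -/
theorem exists_trace_clm {c : ℝ} (hc : c = S.L ∨ c = -S.L) :
    ∃ R : S.H1per →L[ℂ] lp (fun _ : ℤ => ℂ) 2,
      ∀ u m, R u m = (√(freq m) : ℝ) * S.traceCoeff c u.1 m := by
  obtain ⟨C, hC0, hC⟩ := S.exists_traceCoeff_bound
  have hsq : ∀ (u : S.H1per) (m : ℤ), ‖((√(freq m) : ℝ) : ℂ) * S.traceCoeff c u.1 m‖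
      ^ (2 : ENNReal).toReal = freq m * ‖S.traceCoeff c u.1 m‖ ^ 2 := by
    intro u m
    rw [ENNReal.toReal_ofNat, Real.rpow_ofNat, norm_mul, mul_pow, Complex.norm_real,
      Real.norm_eq_abs, sq_abs, Real.sq_sqrt (Nat.cast_nonneg _)]
  have hm : ∀ u : S.H1per, Memℓp (fun m => ((√(freq m) : ℝ) : ℂ) * S.traceCoeff c u.1 m) 2 := by
    intro u
    refine memℓp_gen (summable_of_sum_le (c := C * ‖u.1‖ ^ 2) (fun m => by positivity) fun s => ?_)
    simp only [hsq]
    exact hC c hc u.1 u.2 s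
  let R : S.H1per →ₗ[ℂ] lp (fun _ : ℤ => ℂ) 2 :=
    { toFun := fun u => ⟨_, hm u⟩
      map_add' := fun u v => by
        ext m
        exact (congrArg _ (S.traceCoeff_add hc u.1 v.1 m)).trans (mul_add _ _ _)
      map_smul' := fun a u => by
        ext m
        simp [S.traceCoeff_smul hc]
        ring }
  refine ⟨R.mkContinuous √C fun u => ?_, fun u m => rfl⟩
  refine lp.norm_le_of_forall_sum_le (by simp) (by positivity) fun s => ?_
  change ∑ m ∈ s, ‖((√(freq m) : ℝ) : ℂ) * S.traceCoeff c u.1 m‖ ^ (2 : ENNReal).toReal ≤ _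
  simp only [hsq]
  rw [ENNReal.toReal_ofNat, Real.rpow_ofNat, mul_pow, Real.sq_sqrt hC0]
  exact hC c hc u.1 u.2 s

/-- The boundary form with exponents `e m = freq m * d m`, where `d` is bounded, converges
absolutely and is represented by an operator depending linearly and continuously on `d`. -/
theorem exists_boundary_clm :
    ∃ Φ : (ℤ →ᵇ ℂ) →L[ℂ] (S.H1per →L[ℂ] S.H1per), ∀ (d : ℤ →ᵇ ℂ) (u v : S.H1per),
      Summable (gammaTerm (dtn (fun m => freq m * d m) (S.gammaCoeff u)) (S.gammaCoeff v)) ∧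
      inner ℂ v (Φ d u) = (S.mu0 : ℂ)⁻¹ *
        gammaPair (dtn (fun m => freq m * d m) (S.gammaCoeff u)) (S.gammaCoeff v) := by
  obtain ⟨D, hD⟩ := exists_diagonal_clm
  obtain ⟨R, hR⟩ := S.exists_trace_clm (Or.inl rfl)
  obtain ⟨R', hR'⟩ := S.exists_trace_clm (Or.inr rfl)
  let conjBy (Q : S.H1per →L[ℂ] lp (fun _ : ℤ => ℂ) 2) :
      (lp (fun _ : ℤ => ℂ) 2 →L[ℂ] lp (fun _ : ℤ => ℂ) 2) →L[ℂ] (S.H1per →L[ℂ] S.H1per) :=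
    (ContinuousLinearMap.postcomp S.H1per Q.adjoint).comp
      (ContinuousLinearMap.precomp (lp (fun _ : ℤ => ℂ) 2) Q)
  have hconj : ∀ (Q : S.H1per →L[ℂ] lp (fun _ : ℤ => ℂ) 2) T u v,
      inner ℂ v (conjBy Q T u) = inner ℂ (Q v) (T (Q u)) := fun Q T u v => by
    change inner ℂ v (Q.adjoint (T (Q u))) = _
    rw [ContinuousLinearMap.adjoint_inner_right]
  have hsum : ∀ (c : ℝ) (Q : S.H1per →L[ℂ] lp (fun _ : ℤ => ℂ) 2),
      (∀ u m, Q u m = (√(freq m) : ℝ) * S.traceCoeff c u.1 m) → ∀ (d : ℤ →ᵇ ℂ) (u v : S.H1per),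
      HasSum (fun m => freq m * d m * (S.traceCoeff c u.1 m * conj (S.traceCoeff c v.1 m)))
        (inner ℂ v (conjBy Q (D d) u)) := by
    intro c Q hQ d u v
    rw [hconj]
    have h : ∀ m, freq m * d m * (S.traceCoeff c u.1 m * conj (S.traceCoeff c v.1 m))
        = inner ℂ (Q v m) (D d (Q u) m) := fun m => by
      have : ((√(freq m) : ℝ) : ℂ) * (√(freq m) : ℝ) = freq m := by
        rw [← Complex.ofReal_mul, Real.mul_self_sqrt (Nat.cast_nonneg _), Complex.ofReal_natCast]
      rw [RCLike.inner_apply, hD, hQ, hQ, map_mul, Complex.conj_ofReal, ← this]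
      ring
    rw [funext h]
    exact lp.hasSum_inner (Q v) (D d (Q u))
  refine ⟨((S.mu0 : ℂ)⁻¹ * (2 * Real.pi) * -Complex.I) • ((conjBy R + conjBy R').comp D),
    fun d u v => ?_⟩
  have hs := ((hsum _ R hR d u v).add (hsum _ R' hR' d u v)).mul_left (2 * Real.pi * -Complex.I)
  have ht : ∀ m, gammaTerm (dtn (fun m => freq m * d m) (S.gammaCoeff u)) (S.gammaCoeff v) m
      = 2 * Real.pi * -Complex.I *
        (freq m * d m * (S.traceCoeff S.L u.1 m * conj (S.traceCoeff S.L v.1 m))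
          + freq m * d m * (S.traceCoeff (-S.L) u.1 m * conj (S.traceCoeff (-S.L) v.1 m))) := by
    intro m
    change 2 * (Real.pi : ℂ) * ((-Complex.I * (freq m * d m)) * S.traceCoeff S.L u.1 m
      * conj (S.traceCoeff S.L v.1 m) + (-Complex.I * (freq m * d m)) * S.traceCoeff (-S.L) u.1 m
      * conj (S.traceCoeff (-S.L) v.1 m)) = _
    ring
  have hs' : HasSum (gammaTerm (dtn (fun m => freq m * d m) (S.gammaCoeff u)) (S.gammaCoeff v)) _ :=
    (funext ht) ▸ hs
  refine ⟨hs'.summable, ?_⟩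
  rw [gammaPair, hs'.tsum_eq]
  change inner ℂ v ((((S.mu0 : ℂ)⁻¹ * (2 * Real.pi) * -Complex.I) •
    (conjBy R (D d) + conjBy R' (D d))) u) = _
  rw [inner_smul_clm, inner_add_clm]
  ring

end Slab

/-! ### Analytic branches of the exponents -/

/-- The inverse function theorem gives an analytic square root near `1` in a Banach algebra. -/
theorem exists_analyticAt_sqrt (B : Type*) [NormedCommRing B] [NormedAlgebra ℂ B]
    [CompleteSpace B] :
    ∃ g : B → B, AnalyticAt ℂ g 1 ∧ g 1 = 1 ∧ ∀ᶠ y in 𝓝 (1 : B), g y ^ 2 = y := by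
  have hf : ContDiffAt ℂ ω (fun s : B => s ^ 2) 1 := by fun_prop
  set f' : B ≃L[ℂ] B := ContinuousLinearEquiv.smulLeft (Units.mk0 (2 : ℂ) two_ne_zero) with hf'
  have hd : HasFDerivAt (fun s : B => s ^ 2) (f' : B →L[ℂ] B) 1 := by
    refine ((hasFDerivAt_id (𝕜 := ℂ) (1 : B)).pow 2).congr_fderiv ?_
    ext x
    simp [f', Units.smul_def, two_smul, one_add_one_eq_two]
  have hω : (ω : ℕ∞ω) ≠ 0 := by simp
  refine ⟨hf.localInverse hd hω, ?_, ?_, ?_⟩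
  · have := hf.to_localInverse hd hω
    rw [one_pow] at this
    exact this.analyticAt
  · simpa using hf.localInverse_apply_image hd hω
  · simpa [ContDiffAt.localInverse] using
      (hf.hasStrictFDerivAt' hd hω).eventually_right_inverse

namespace Slab

variable (S : Slab)

/-- If no `η_m²` vanishes, then `|η_m²|` is bounded below by a multiple of `1 + |m + κ|`. -/
theorem exists_le_norm_etaSq {p : ℂ × ℂ} (hp : ∀ m, S.etaSq m p ≠ 0) :
    ∃ C : ℝ, 0 ≤ C ∧ ∀ m : ℤ, 1 + ‖(m : ℂ) + p.1‖ ≤ C * ‖S.etaSq m p‖ := by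
  set a : ℝ := ‖(S.eps0 : ℂ) * S.mu0 * p.2 ^ 2‖ with ha
  have ha0 : 0 ≤ a := norm_nonneg _
  have hfin : {m : ℤ | ‖(m : ℂ) + p.1‖ < a + 2}.Finite := by
    refine (Set.finite_Icc (-⌈a + 2 + ‖p.1‖⌉) ⌈a + 2 + ‖p.1‖⌉).subset fun m hm => ?_
    have h1 : |(m : ℝ)| ≤ a + 2 + ‖p.1‖ := by
      have h2 : ‖(m : ℂ)‖ ≤ ‖(m : ℂ) + p.1‖ + ‖p.1‖ := by
        simpa using norm_sub_le ((m : ℂ) + p.1) p.1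
      rw [Complex.norm_intCast] at h2
      rw [mem_ofPred_eq] at hm
      linarith
    have h3 := (abs_le.1 h1)
    have h4 := Int.le_ceil (a + 2 + ‖p.1‖)
    constructor
    · have : (-(⌈a + 2 + ‖p.1‖⌉ : ℤ) : ℝ) ≤ m := by linarith
      exact_mod_cast this
    · have : (m : ℝ) ≤ (⌈a + 2 + ‖p.1‖⌉ : ℤ) := by linarith
      exact_mod_cast this
  -- off the finite set `F`, `|m + κ|² - a ≥ 1 + |m + κ|`
  set F := hfin.toFinset with hF
  have hterm : ∀ m : ℤ, 0 ≤ (1 + ‖(m : ℂ) + p.1‖) / ‖S.etaSq m p‖ := fun m => by positivity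
  refine ⟨1 + ∑ m ∈ F, (1 + ‖(m : ℂ) + p.1‖) / ‖S.etaSq m p‖,
    add_nonneg zero_le_one (Finset.sum_nonneg fun m _ => hterm m), fun m => ?_⟩
  have hpos : 0 < ‖S.etaSq m p‖ := norm_pos_iff.2 (hp m)
  by_cases hm : m ∈ F
  · rw [← div_le_iff₀ hpos]
    have := Finset.single_le_sum (fun m _ => hterm m) hm
    linarith
  · have ht : a + 2 ≤ ‖(m : ℂ) + p.1‖ := by
      by_contra! h
      exact hm (hfin.mem_toFinset.2 h)
    have h1 : ‖(m : ℂ) + p.1‖ ^ 2 - a ≤ ‖S.etaSq m p‖ := by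
      rw [etaSq, ← norm_pow, norm_sub_rev]
      exact norm_sub_norm_le _ _
    have h2 : 1 + ‖(m : ℂ) + p.1‖ ≤ ‖S.etaSq m p‖ := by nlinarith
    refine h2.trans (le_mul_of_one_le_left (norm_nonneg _) ?_)
    linarith [Finset.sum_nonneg fun m (_ : m ∈ F) => hterm m]

/-- Relative to a base point, the numbers `η_m²` depend on `(κ, ω)` through a polynomial with values
in the bounded sequences. -/
theorem exists_etaSq_ratio {p₀ : ℂ × ℂ} (hp : ∀ m, S.etaSq m p₀ ≠ 0) :
    ∃ r : ℂ × ℂ → (ℤ →ᵇ ℂ), (∀ p, AnalyticAt ℂ r p) ∧ r p₀ = 1 ∧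
      ∀ p m, S.etaSq m p = S.etaSq m p₀ * r p m := by
  obtain ⟨C, hC0, hC⟩ := S.exists_le_norm_etaSq hp
  have hpos : ∀ m, 0 < ‖S.etaSq m p₀‖ := fun m => norm_pos_iff.2 (hp m)
  set α : ℤ →ᵇ ℂ := BoundedContinuousFunction.ofNormedAddCommGroupDiscrete
    (fun m : ℤ => ((m : ℂ) + p₀.1) / S.etaSq m p₀) C (fun m => by
      rw [norm_div, div_le_iff₀ (hpos m)]
      linarith [hC m])
  set β : ℤ →ᵇ ℂ := BoundedContinuousFunction.ofNormedAddCommGroupDiscrete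
    (fun m : ℤ => 1 / S.etaSq m p₀) C (fun m => by
      rw [norm_div, div_le_iff₀ (hpos m), norm_one]
      linarith [hC m, norm_nonneg ((m : ℂ) + p₀.1)])
  refine ⟨fun p => 1 + (-2 * (p.1 - p₀.1)) • α
    + ((S.eps0 : ℂ) * S.mu0 * (p.2 ^ 2 - p₀.2 ^ 2) - (p.1 - p₀.1) ^ 2) • β, fun p => ?_, ?_, ?_⟩
  · have h1 : AnalyticAt ℂ (fun p : ℂ × ℂ => p.1) p := analyticAt_fst
    have h2 : AnalyticAt ℂ (fun p : ℂ × ℂ => p.2) p := analyticAt_snd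
    have h3 : AnalyticAt ℂ (fun p : ℂ × ℂ => -2 * (p.1 - p₀.1)) p :=
      analyticAt_const.mul (h1.sub analyticAt_const)
    have h4 : AnalyticAt ℂ (fun p : ℂ × ℂ =>
        (S.eps0 : ℂ) * S.mu0 * (p.2 ^ 2 - p₀.2 ^ 2) - (p.1 - p₀.1) ^ 2) p :=
      (analyticAt_const.mul ((h2.pow 2).sub analyticAt_const)).sub ((h1.sub analyticAt_const).pow 2)
    exact (analyticAt_const.add (h3.smul analyticAt_const)).add (h4.smul analyticAt_const)
  · simp
  · intro p m
    have hm := hp m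
    have hα : α m = ((m : ℂ) + p₀.1) / S.etaSq m p₀ := rfl
    have hβ : β m = 1 / S.etaSq m p₀ := rfl
    simp only [BoundedContinuousFunction.coe_add, BoundedContinuousFunction.coe_smul, Pi.add_apply,
      BoundedContinuousFunction.coe_one, Pi.one_apply, smul_eq_mul, hα, hβ]
    field_simp
    simp only [etaSq]
    ring

/-- A common neighbourhood on which the ratios of the `η_m²` to their values at the base point have
square roots that are close to `1` uniformly in `m` and analytic as a bounded sequence. -/
theorem exists_etaSq_eq_mul_sq {p₀ : ℂ × ℂ} (hp : ∀ m, S.etaSq m p₀ ≠ 0) :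
    ∃ s : ℂ × ℂ → (ℤ →ᵇ ℂ), s p₀ = 1 ∧ ∀ᶠ p in 𝓝 p₀, AnalyticAt ℂ s p ∧
      ∀ m, S.etaSq m p = S.etaSq m p₀ * s p m ^ 2 ∧ ‖s p m - 1‖ < 1 / 2 := by
  obtain ⟨r, hr, hr1, hreq⟩ := S.exists_etaSq_ratio hp
  obtain ⟨g, hg, hg1, hgsq⟩ := exists_analyticAt_sqrt (ℤ →ᵇ ℂ)
  have hs : AnalyticAt ℂ (fun p => g (r p)) p₀ := by
    refine AnalyticAt.fun_comp ?_ (hr p₀)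
    rwa [hr1]
  have hs1 : g (r p₀) = 1 := by rw [hr1, hg1]
  have hnear : ∀ᶠ p in 𝓝 p₀, g (r p) ∈ Metric.ball (1 : ℤ →ᵇ ℂ) (1 / 2) := by
    refine hs.continuousAt.eventually (Metric.isOpen_ball.mem_nhds ?_)
    simp only [hs1]
    exact Metric.mem_ball_self (by norm_num)
  have hsq : ∀ᶠ p in 𝓝 p₀, g (r p) ^ 2 = r p := by
    rw [← hr1] at hgsq
    exact (hr p₀).continuousAt.eventually hgsq
  refine ⟨fun p => g (r p), hs1, ?_⟩
  filter_upwards [hs.eventually_analyticAt, hnear, hsq] with p h1 h2 h3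
  refine ⟨h1, fun m => ⟨?_, ?_⟩⟩
  · rw [hreq p m]
    conv_lhs => rw [← h3]
    rfl
  · rw [Metric.mem_ball, dist_eq_norm] at h2
    exact ((g (r p) - 1).norm_coe_le_norm m).trans_lt h2

theorem ne_zero_of_norm_sub_one_lt {z : ℂ} (hz : ‖z - 1‖ < 1 / 2) : z ≠ 0 := by
  rintro rfl
  norm_num at hz

/-- Any choice of square roots continues to an analytic branch on a common neighbourhood. -/
theorem exists_isBranch {p₀ : ℂ × ℂ} (hp : ∀ m, S.etaSq m p₀ ≠ 0) {e : ℤ → ℂ}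
    (he : ∀ m, e m ^ 2 = S.etaSq m p₀) :
    ∃ (U : Set (ℂ × ℂ)) (η : ℤ → ℂ × ℂ → ℂ), IsOpen U ∧ p₀ ∈ U ∧ S.IsBranch η U ∧
      ∀ m, η m p₀ = e m := by
  obtain ⟨s, hs1, hs⟩ := S.exists_etaSq_eq_mul_sq hp
  obtain ⟨U, hU, hUo, hpU⟩ := eventually_nhds_iff.1 hs
  refine ⟨U, fun m p => e m * s p m, hUo, hpU, fun m => ⟨fun p hpU => ?_, fun p hpU => ⟨?_, ?_⟩⟩,
    fun m => ?_⟩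
  · exact analyticAt_const.mul
      ((BoundedContinuousFunction.evalCLM ℂ m).analyticAt _ |>.fun_comp (hU p hpU).1)
  · rw [((hU p hpU).2 m).1]
    exact mul_ne_zero (hp m) (pow_ne_zero _ (ne_zero_of_norm_sub_one_lt ((hU p hpU).2 m).2))
  · rw [((hU p hpU).2 m).1, mul_pow, he]
  · simp [hs1]

theorem exists_norm_eta_le {p : ℂ × ℂ} {e : ℤ → ℂ} (he : ∀ m, e m ^ 2 = S.etaSq m p) :
    ∃ C : ℝ, ∀ m, ‖e m / freq m‖ ≤ C := by
  set a : ℝ := ‖(S.eps0 : ℂ) * S.mu0 * p.2 ^ 2‖ with ha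
  have ha0 : 0 ≤ a := norm_nonneg _
  refine ⟨√(a + (1 + ‖p.1‖) ^ 2), fun m => Real.le_sqrt_of_sq_le ?_⟩
  have hK : (1 : ℝ) ≤ freq m := by exact_mod_cast freq_pos m
  have hmK : ‖(m : ℂ)‖ ≤ freq m := by
    rw [Complex.norm_intCast, ← Int.cast_abs, ← Nat.cast_natAbs]
    exact_mod_cast le_max_right _ _
  have h1 : ‖(m : ℂ) + p.1‖ ≤ freq m * (1 + ‖p.1‖) := by
    refine (norm_add_le _ _).trans ?_
    nlinarith [norm_nonneg p.1]
  rw [← norm_pow, div_pow, he, norm_div, norm_pow, Complex.norm_natCast,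
    div_le_iff₀ (by positivity)]
  calc ‖S.etaSq m p‖ ≤ a + ‖(m : ℂ) + p.1‖ ^ 2 := by
        rw [etaSq, ← norm_pow]; exact norm_sub_le _ _
    _ ≤ a * (freq m : ℝ) ^ 2 + (freq m * (1 + ‖p.1‖)) ^ 2 := by
        gcongr
        exact le_mul_of_one_le_right ha0 (one_le_pow₀ hK)
    _ = _ := by ring

/-- The symbol of the Dirichlet-to-Neumann map, divided by its order, is locally an analytic
function with values in the bounded sequences: on a ball, a branch is determined by its values at
the centre. -/
theorem IsBranch.exists_analyticAt_symbol {η : ℤ → ℂ × ℂ → ℂ} {U : Set (ℂ × ℂ)} (hU : IsOpen U)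
    (h : S.IsBranch η U) {p₀ : ℂ × ℂ} (hp₀ : p₀ ∈ U) :
    ∃ d : ℂ × ℂ → (ℤ →ᵇ ℂ), AnalyticAt ℂ d p₀ ∧ ∀ᶠ p in 𝓝 p₀, ∀ m, η m p = freq m * d p m := by
  obtain ⟨s, hs1, hs⟩ := S.exists_etaSq_eq_mul_sq fun m => ((h m).2 p₀ hp₀).1
  obtain ⟨C, hC⟩ := S.exists_norm_eta_le (e := fun m => η m p₀) fun m => ((h m).2 p₀ hp₀).2
  set ρ : ℤ →ᵇ ℂ := BoundedContinuousFunction.ofNormedAddCommGroupDiscrete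
    (fun m : ℤ => η m p₀ / freq m) C hC
  refine ⟨fun p => ρ * s p, analyticAt_const.mul hs.self_of_nhds.1, ?_⟩
  obtain ⟨δ, hδ, hball⟩ := Metric.eventually_nhds_iff_ball.1 (hs.and (hU.mem_nhds hp₀))
  filter_upwards [Metric.ball_mem_nhds p₀ hδ] with p hp m
  have hη0 : η m p₀ ≠ 0 := fun h0 => by
    have := (h m).2 p₀ hp₀
    rw [h0] at this
    exact this.1 (by rw [← this.2]; simp)
  have hf : (freq m : ℂ) ≠ 0 := by exact_mod_cast (freq_pos m).ne'
  have key : EqOn (η m) (fun p => η m p₀ * s p m) (Metric.ball p₀ δ) := by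
    refine (convex_ball p₀ δ).isPreconnected.eq_of_sq_eq
      (fun q hq => ((h m).1 q (hball q hq).2).continuousAt.continuousWithinAt)
      (fun q hq => ?_) (fun q hq => ?_) (fun {q} hq => ?_) (Metric.mem_ball_self hδ) ?_
    · have := ((BoundedContinuousFunction.evalCLM ℂ m).analyticAt _ |>.fun_comp
        (hball q hq).1.1 : AnalyticAt ℂ (fun p => s p m) q)
      exact (analyticAt_const.mul this).continuousAt.continuousWithinAt
    · simp only [Pi.pow_apply]
      rw [((h m).2 q (hball q hq).2).2, mul_pow, ((h m).2 p₀ hp₀).2, ((hball q hq).1.2 m).1]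
    · exact mul_ne_zero hη0 (ne_zero_of_norm_sub_one_lt ((hball q hq).1.2 m).2)
    · simp [hs1]
  rw [key hp]
  change η m p₀ * s p m = freq m * (η m p₀ / freq m * s p m)
  field_simp

end Slab

/-! ### Analyticity of the operators -/

section

variable {E H : Type*} [NormedAddCommGroup E] [NormedSpace ℂ E] [NormedAddCommGroup H]
  [NormedSpace ℂ H] {p : E}

theorem analyticAt_smul_clm {f : E → ℂ} (hf : AnalyticAt ℂ f p) (B : H →L[ℂ] H) :
    AnalyticAt ℂ (fun p => f p • B) p :=
  hf.smul analyticAt_const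

theorem analyticAt_clm_apply {F : Type*} [NormedAddCommGroup F] [NormedSpace ℂ F] {f : E → F}
    (hf : AnalyticAt ℂ f p) (Φ : F →L[ℂ] (H →L[ℂ] H)) : AnalyticAt ℂ (fun p => Φ (f p)) p :=
  (Φ.analyticAt _).fun_comp hf

theorem analyticAt_one_add_inverse_mul [CompleteSpace H] {f g : E → H →L[ℂ] H}
    (hf : AnalyticAt ℂ f p) (hg : AnalyticAt ℂ g p) (hu : IsUnit (f p)) :
    AnalyticAt ℂ (fun p => 1 + Ring.inverse (f p) * g p) p := by
  obtain ⟨x, hx⟩ := hu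
  have h1 : AnalyticAt ℂ (fun p => Ring.inverse (f p)) p := by
    refine AnalyticAt.fun_comp ?_ hf
    rw [← hx]
    exact analyticAt_inverse x
  exact analyticAt_const.add (h1.mul hg)

end

theorem eventually_isUnit_clm {E H : Type*} [TopologicalSpace E] [NormedAddCommGroup H]
    [NormedSpace ℂ H] [CompleteSpace H] {p : E} {f : E → H →L[ℂ] H} (hf : ContinuousAt f p)
    (hu : IsUnit (f p)) : ∀ᶠ q in 𝓝 p, IsUnit (f q) :=
  hf (Units.isOpen.mem_nhds hu)

namespace Slab

variable (S : Slab)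

variable {S} in
theorem Represents.opOf_eq {T : S.H1per →L[ℂ] S.H1per} {c : S.H1per → S.H1per → ℂ}
    (h : S.Represents T c) : S.opOf c = T := by
  have hex : ∃ T, S.Represents T c := ⟨T, h⟩
  rw [opOf, dif_pos hex]
  ext1 u
  refine ext_inner_left ℂ fun v => ?_
  rw [h, hex.choose_spec]

variable {S} in
theorem Represents.opOf {T : S.H1per →L[ℂ] S.H1per} {c : S.H1per → S.H1per → ℂ}
    (h : S.Represents T c) : S.Represents (S.opOf c) c := by
  rwa [h.opOf_eq]

/-- Locally, `C₁` is a polynomial in `κ` plus a continuous linear function of the symbol of the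
Dirichlet-to-Neumann map. -/
theorem IsBranch.exists_represents_c1 {η : ℤ → ℂ × ℂ → ℂ} {U : Set (ℂ × ℂ)} (hU : IsOpen U)
    (h : S.IsBranch η U) {p₀ : ℂ × ℂ} (hp₀ : p₀ ∈ U) :
    ∃ T : ℂ × ℂ → S.H1per →L[ℂ] S.H1per, AnalyticAt ℂ T p₀ ∧
      ∀ᶠ p in 𝓝 p₀, S.Represents (T p) (S.c1 η p) ∧ ∀ u v : S.H1per,
        Summable (gammaTerm (dtn (fun m => η m p) (S.gammaCoeff u)) (S.gammaCoeff v)) := by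
  obtain ⟨d, hd, hηd⟩ := h.exists_analyticAt_symbol S hU hp₀
  obtain ⟨T₀, T₁, T₂, hT⟩ := S.exists_volume_clm
  obtain ⟨B, hB⟩ := S.exists_represents_b
  obtain ⟨Φ, hΦ⟩ := S.exists_boundary_clm
  refine ⟨fun p => (T₀ + p.1 • T₁ + p.1 ^ 2 • T₂) + Φ (d p) + B, ?_, ?_⟩
  · have h1 : AnalyticAt ℂ (fun p : ℂ × ℂ => p.1) p₀ := analyticAt_fst
    exact (((analyticAt_const.add (analyticAt_smul_clm h1 T₁)).add
      (analyticAt_smul_clm (h1.pow 2) T₂)).add (analyticAt_clm_apply hd Φ)).add analyticAt_const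
  · filter_upwards [hηd] with p hp
    have hp' : (fun m => η m p) = fun m => freq m * d p m := funext hp
    refine ⟨fun u v => ?_, fun u v => ?_⟩
    · rw [inner_add_clm, inner_add_clm, hT, (hΦ _ u v).2, hB, c1, Slab.h, hp']
    · rw [hp']
      exact (hΦ _ u v).1

theorem exists_represents_c2 : ∃ B : S.H1per →L[ℂ] S.H1per, ∀ p : ℂ × ℂ,
    S.Represents (-(p.2 ^ 2 + 1) • B) (S.c2 p) := by
  obtain ⟨B, hB⟩ := S.exists_represents_b
  exact ⟨B, fun p u v => by rw [inner_smul_clm, hB, c2]⟩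

theorem represents_C2 (p : ℂ × ℂ) : S.Represents (S.C2 p) (S.c2 p) := by
  obtain ⟨B, hB⟩ := S.exists_represents_c2
  exact (hB p).opOf

theorem analyticAt_C2 (p : ℂ × ℂ) : AnalyticAt ℂ S.C2 p := by
  obtain ⟨B, hB⟩ := S.exists_represents_c2
  have : S.C2 = fun p => -(p.2 ^ 2 + 1) • B := funext fun p => (hB p).opOf_eq
  rw [this]
  have h2 : AnalyticAt ℂ (fun p : ℂ × ℂ => p.2) p := analyticAt_snd
  have h3 : AnalyticAt ℂ (fun p : ℂ × ℂ => -(p.2 ^ 2 + 1)) p :=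
    ((h2.pow 2).add analyticAt_const).neg
  exact analyticAt_smul_clm h3 B

theorem IsBranch.represents_C1 {η : ℤ → ℂ × ℂ → ℂ} {U : Set (ℂ × ℂ)} (hU : IsOpen U)
    (h : S.IsBranch η U) {p : ℂ × ℂ} (hp : p ∈ U) : S.Represents (S.C1 η p) (S.c1 η p) := by
  obtain ⟨T, _, hT⟩ := h.exists_represents_c1 S hU hp
  exact hT.self_of_nhds.1.opOf

theorem IsBranch.summable_gammaTerm {η : ℤ → ℂ × ℂ → ℂ} {U : Set (ℂ × ℂ)} (hU : IsOpen U)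
    (h : S.IsBranch η U) {p : ℂ × ℂ} (hp : p ∈ U) (u v : S.H1per) :
    Summable (gammaTerm (dtn (fun m => η m p) (S.gammaCoeff u)) (S.gammaCoeff v)) := by
  obtain ⟨T, _, hT⟩ := h.exists_represents_c1 S hU hp
  exact hT.self_of_nhds.2 u v

theorem IsBranch.analyticAt_C1 {η : ℤ → ℂ × ℂ → ℂ} {U : Set (ℂ × ℂ)} (hU : IsOpen U)
    (h : S.IsBranch η U) {p : ℂ × ℂ} (hp : p ∈ U) : AnalyticAt ℂ (S.C1 η) p := by
  obtain ⟨T, hTa, hT⟩ := h.exists_represents_c1 S hU hp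
  refine hTa.congr ?_
  filter_upwards [hT] with q hq using hq.1.opOf_eq.symm

theorem IsBranch.analyticAt_A {η : ℤ → ℂ × ℂ → ℂ} {U : Set (ℂ × ℂ)} (hU : IsOpen U)
    (h : S.IsBranch η U) {p : ℂ × ℂ} (hp : p ∈ U) (hu : IsUnit (S.C1 η p)) :
    AnalyticAt ℂ (S.A η) p :=
  analyticAt_one_add_inverse_mul (h.analyticAt_C1 S hU hp) (S.analyticAt_C2 p) hu

end Slab

/-! ### The outgoing branch near the real pairs -/

theorem sqrtCut_sq (w : ℂ) : sqrtCut w ^ 2 = w := by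
  have h1 : (Complex.exp (Real.pi / 4 * Complex.I)) ^ 2 = Complex.I := by
    have h : ((2 : ℕ) : ℂ) * (Real.pi / 4 * Complex.I) = Real.pi / 2 * Complex.I := by
      push_cast
      ring
    rw [← Complex.exp_nat_mul, h, Complex.exp_pi_div_two_mul_I]
  have h2 : ((-Complex.I * w) ^ (1 / 2 : ℂ)) ^ 2 = -Complex.I * w := by
    have := Complex.cpow_nat_inv_pow (-Complex.I * w) two_ne_zero
    rwa [Nat.cast_two, ← one_div] at this
  rw [sqrtCut, mul_pow, h1, h2]
  linear_combination -w * Complex.I_sq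

theorem analyticAt_sqrtCut {w : ℂ} (hw : -Complex.I * w ∈ Complex.slitPlane) :
    AnalyticAt ℂ sqrtCut w := by
  unfold sqrtCut
  exact analyticAt_const.mul ((analyticAt_const.mul analyticAt_id).cpow analyticAt_const hw)

namespace Slab

variable (S : Slab)

/-- The pairs at which every `η_m²` stays off the closed negative imaginary axis. -/
def offCut : Set (ℂ × ℂ) := {p | ∀ m, -Complex.I * S.etaSq m p ∈ Complex.slitPlane}

theorem isBranch_eta : S.IsBranch S.eta (interior S.offCut) := by
  intro m
  refine ⟨fun p hp => ?_, fun p hp => ⟨fun h0 => ?_, sqrtCut_sq _⟩⟩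
  · refine (analyticAt_sqrtCut (interior_subset hp m)).fun_comp ?_
    have h1 : AnalyticAt ℂ (fun p : ℂ × ℂ => p.1) p := analyticAt_fst
    have h2 : AnalyticAt ℂ (fun p : ℂ × ℂ => p.2) p := analyticAt_snd
    exact (analyticAt_const.mul (h2.pow 2)).sub ((analyticAt_const.add h1).pow 2)
  · have := interior_subset hp m
    rw [h0, mul_zero] at this
    exact Complex.zero_notMem_slitPlane this

/-- The value of `η_m²` at a real pair, as a real number. -/
def realEtaSq (m : ℤ) (r : ℝ × ℝ) : ℝ := S.eps0 * S.mu0 * r.2 ^ 2 - (m + r.1) ^ 2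

theorem etaSq_toComplex (m : ℤ) (r : ℝ × ℝ) : S.etaSq m (toComplex r) = S.realEtaSq m r := by
  simp [etaSq, realEtaSq, toComplex]

theorem toComplex_mem_interior_offCut {r : ℝ × ℝ} (hr : ∀ m, S.etaSq m (toComplex r) ≠ 0) :
    toComplex r ∈ interior S.offCut := by
  obtain ⟨s, _, hs⟩ := S.exists_etaSq_eq_mul_sq hr
  rw [mem_interior_iff_mem_nhds]
  filter_upwards [hs] with p hp m
  obtain ⟨h1, h2⟩ := hp.2 m
  have ht : S.realEtaSq m r ≠ 0 := fun h0 => hr m (by rw [etaSq_toComplex, h0, Complex.ofReal_zero])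
  rw [h1, etaSq_toComplex]
  -- `Re z > 1/2 > |Im z|`, so `z²` lies in the right half plane and `η_m²` off the imaginary axis
  set z := s p m
  have hre : |z.re - 1| < 1 / 2 := by
    simpa using (Complex.abs_re_le_norm (z - 1)).trans_lt h2
  have him : |z.im| < 1 / 2 := by
    simpa using (Complex.abs_im_le_norm (z - 1)).trans_lt h2
  rw [abs_lt] at hre him
  have hz : 0 < z.re ^ 2 - z.im ^ 2 := by nlinarith
  refine Complex.mem_slitPlane_iff.2 (Or.inr ?_)
  have : (-Complex.I * (S.realEtaSq m r * z ^ 2)).im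
      = -(S.realEtaSq m r * (z.re ^ 2 - z.im ^ 2)) := by
    simp [pow_two]
  rw [this, neg_ne_zero]
  exact mul_ne_zero ht hz.ne'

theorem eta_im_nonneg {r : ℝ × ℝ} {m : ℤ} (hr : S.etaSq m (toComplex r) ≠ 0) :
    0 ≤ (S.eta m (toComplex r)).im := by
  rw [etaSq_toComplex] at hr
  rw [eta, etaSq_toComplex]
  rcases lt_or_gt_of_ne (Complex.ofReal_ne_zero.1 hr) with h | h
  · have := sqrtCut_of_neg (neg_pos.2 h)
    rw [Complex.ofReal_neg, neg_neg] at this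
    rw [this]
    simp
  · rw [sqrtCut_of_pos h]
    simp

theorem gammaPair_dtn_re_nonneg {e : ℤ → ℂ} (he : ∀ m, 0 ≤ (e m).im) {f : ℤ → ℂ × ℂ}
    (hs : Summable (gammaTerm (dtn e f) f)) : 0 ≤ (gammaPair (dtn e f) f).re := by
  rw [gammaPair, Complex.re_tsum hs]
  refine tsum_nonneg fun m => ?_
  have : gammaTerm (dtn e f) f m
      = -Complex.I * e m * ((2 * Real.pi * (‖(f m).1‖ ^ 2 + ‖(f m).2‖ ^ 2) : ℝ) : ℂ) := by
    have h1 := Complex.mul_conj' (f m).1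
    have h2 := Complex.mul_conj' (f m).2
    simp only [gammaTerm, dtn, Prod.smul_fst, Prod.smul_snd, smul_eq_mul]
    push_cast
    linear_combination (2 * Real.pi * -Complex.I * e m) * (h1 + h2)
  rw [this, Complex.re_mul_ofReal]
  have h3 : (-Complex.I * e m).re = (e m).im := by simp
  rw [h3]
  have := he m
  have := Real.pi_pos
  positivity

theorem norm_sq_L2 (f : S.L2) : ‖f‖ ^ 2 = ∫ q, ‖f q‖ ^ 2 ∂S.vol := by
  have h := inner_self_eq_norm_sq_to_K (𝕜 := ℂ) f
  rw [L2.inner_def] at h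
  simp only [inner_self_eq_norm_sq_to_K, Complex.coe_algebraMap] at h
  have h2 : ((∫ q, ‖f q‖ ^ 2 ∂S.vol : ℝ) : ℂ) = ((‖f‖ ^ 2 : ℝ) : ℂ) := by
    rw [← integral_complex_ofReal]
    push_cast
    exact h
  exact (Complex.ofReal_injective h2).symm

/-- At a real pair, the real part of the form `c₁` dominates the square of the `H¹` norm: the
outgoing Dirichlet-to-Neumann map contributes `Re(-i η_m) = Im η_m ≥ 0`. -/
theorem exists_coercive_c1 {r : ℝ × ℝ} (hr : ∀ m, S.etaSq m (toComplex r) ≠ 0) :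
    ∃ δ : ℝ, 0 < δ ∧ ∀ u : S.H1per, δ * ‖u‖ ^ 2 ≤ (S.c1 S.eta (toComplex r) u u).re := by
  obtain ⟨a, a', ha, hε⟩ := S.eps_bounds
  obtain ⟨b', b, hb', hμ⟩ := S.mu_bounds
  have hb : 0 < b := hb'.trans ((hμ 0).1.trans (hμ 0).2)
  set δ := min a b⁻¹ with hδ
  have hδ0 : 0 < δ := lt_min ha (inv_pos.2 hb)
  set k := r.1
  refine ⟨δ / (2 + 2 * k ^ 2), by positivity, fun u => ?_⟩
  obtain ⟨Cμ, hCμ⟩ := S.mu_inv_abs_bound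
  obtain ⟨Cε, hCε⟩ := S.eps_abs_bound
  set X : ℝ × ℝ → ℂ := fun q => u.1 1 q + Complex.I * k * u.1 0 q with hX
  have i0 : Integrable (fun q => ‖u.1 0 q‖ ^ 2) S.vol :=
    (Lp.memLp (u.1 0)).integrable_norm_pow two_ne_zero
  have i1 : Integrable (fun q => ‖u.1 1 q‖ ^ 2) S.vol :=
    (Lp.memLp (u.1 1)).integrable_norm_pow two_ne_zero
  have i2 : Integrable (fun q => ‖u.1 2 q‖ ^ 2) S.vol :=
    (Lp.memLp (u.1 2)).integrable_norm_pow two_ne_zero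
  have iX : Integrable (fun q => ‖X q‖ ^ 2) S.vol :=
    ((Lp.memLp (u.1 1)).add ((Lp.memLp (u.1 0)).const_mul (Complex.I * k))).integrable_norm_pow
      two_ne_zero
  set F : ℝ × ℝ → ℝ := fun q => (S.mu q)⁻¹ * (‖X q‖ ^ 2 + ‖u.1 2 q‖ ^ 2) with hF
  set G : ℝ × ℝ → ℝ := fun q => S.eps q * ‖u.1 0 q‖ ^ 2 with hG
  have iF : Integrable F S.vol := (iX.add i2).bdd_mul (c := Cμ)
    S.mu_measurable.inv.aestronglyMeasurable (ae_of_all _ hCμ)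
  have iG : Integrable G S.vol := i0.bdd_mul (c := Cε)
    S.eps_measurable.aestronglyMeasurable (ae_of_all _ hCε)
  have hc : S.c1 S.eta (toComplex r) u u = ((∫ q, F q ∂S.vol : ℝ) : ℂ)
      + ((S.mu0⁻¹ : ℝ) : ℂ) * gammaPair (dtn (fun m => S.eta m (toComplex r)) (S.gammaCoeff u))
        (S.gammaCoeff u) + ((∫ q, G q ∂S.vol : ℝ) : ℂ) := by
    rw [c1, Slab.h, Slab.b, ← integral_complex_ofReal, ← integral_complex_ofReal,
      Complex.ofReal_inv]
    congr 1
    · congr 1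
      refine integral_congr_ae (ae_of_all _ fun q => ?_)
      simp only [hF]
      have h1 := Complex.mul_conj' (X q)
      have h2 := Complex.mul_conj' (u.1 2 q)
      have h3 : conj (X q) = conj (u.1 1 q) - Complex.I * k * conj (u.1 0 q) := by
        simp [hX]; ring
      rw [h3] at h1
      push_cast
      rw [← h1, ← h2]
      rfl
    · refine integral_congr_ae (ae_of_all _ fun q => ?_)
      simp only [hG]
      rw [Complex.mul_conj']
      push_cast
      rfl
  have hbdry := gammaPair_dtn_re_nonneg (fun m => S.eta_im_nonneg (hr m))
    (S.isBranch_eta.summable_gammaTerm S isOpen_interior (S.toComplex_mem_interior_offCut hr) u u)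
  have hn : ‖u‖ ^ 2 = ∫ q, (‖u.1 0 q‖ ^ 2 + ‖u.1 1 q‖ ^ 2 + ‖u.1 2 q‖ ^ 2) ∂S.vol := by
    have i01 : Integrable (fun q => ‖u.1 0 q‖ ^ 2 + ‖u.1 1 q‖ ^ 2) S.vol := i0.add i1
    rw [integral_add i01 i2, integral_add i0 i1, ← norm_sq_L2, ← norm_sq_L2, ← norm_sq_L2]
    change ‖u.1‖ ^ 2 = _
    rw [PiLp.norm_sq_eq_of_L2, Fin.sum_univ_three]
  have hmain : δ / (2 + 2 * k ^ 2) * ‖u‖ ^ 2 ≤ ∫ q, F q ∂S.vol + ∫ q, G q ∂S.vol := by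
    rw [hn, ← integral_const_mul, ← integral_add iF iG]
    refine integral_mono (((i0.add i1).add i2).const_mul _) (iF.add iG) fun q => ?_
    have h1 : ‖u.1 1 q‖ ^ 2 ≤ 2 * ‖X q‖ ^ 2 + 2 * k ^ 2 * ‖u.1 0 q‖ ^ 2 := by
      have e : u.1 1 q = X q - Complex.I * k * u.1 0 q := by simp [hX]
      have h2 : ‖u.1 1 q‖ ≤ ‖X q‖ + |k| * ‖u.1 0 q‖ := by
        conv_lhs => rw [e]
        refine (norm_sub_le _ _).trans (le_of_eq ?_)
        rw [norm_mul, norm_mul, Complex.norm_I, one_mul, Complex.norm_real, Real.norm_eq_abs]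
      calc ‖u.1 1 q‖ ^ 2 ≤ (‖X q‖ + |k| * ‖u.1 0 q‖) ^ 2 := by gcongr
        _ ≤ 2 * ‖X q‖ ^ 2 + 2 * (|k| * ‖u.1 0 q‖) ^ 2 := by
            nlinarith [sq_nonneg (‖X q‖ - |k| * ‖u.1 0 q‖)]
        _ = _ := by rw [mul_pow, sq_abs]; ring
    have hm : δ ≤ (S.mu q)⁻¹ := (min_le_right _ _).trans
      (inv_anti₀ (hb'.trans (hμ q).1) (hμ q).2.le)
    have he : δ ≤ S.eps q := (min_le_left _ _).trans (hε q).1.le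
    calc δ / (2 + 2 * k ^ 2) * (‖u.1 0 q‖ ^ 2 + ‖u.1 1 q‖ ^ 2 + ‖u.1 2 q‖ ^ 2)
        ≤ δ / (2 + 2 * k ^ 2) *
            ((2 + 2 * k ^ 2) * (‖X q‖ ^ 2 + ‖u.1 2 q‖ ^ 2 + ‖u.1 0 q‖ ^ 2)) := by
          gcongr
          nlinarith [sq_nonneg ‖X q‖, sq_nonneg ‖u.1 0 q‖, sq_nonneg ‖u.1 2 q‖, sq_nonneg k,
            mul_nonneg (sq_nonneg k) (sq_nonneg ‖X q‖),
            mul_nonneg (sq_nonneg k) (sq_nonneg ‖u.1 2 q‖)]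
      _ = δ * (‖X q‖ ^ 2 + ‖u.1 2 q‖ ^ 2) + δ * ‖u.1 0 q‖ ^ 2 := by
          field_simp
      _ ≤ F q + G q := by
          simp only [hF, hG]
          gcongr
  rw [hc, Complex.add_re, Complex.add_re, Complex.re_ofReal_mul, Complex.ofReal_re,
    Complex.ofReal_re]
  have := mul_nonneg (inv_nonneg.2 S.mu0_pos.le) hbdry
  linarith

theorem isUnit_C1_toComplex {r : ℝ × ℝ} (hr : ∀ m, S.etaSq m (toComplex r) ≠ 0) :
    IsUnit (S.C1 S.eta (toComplex r)) := by
  obtain ⟨δ, hδ, h⟩ := S.exists_coercive_c1 hr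
  have hrep := S.isBranch_eta.represents_C1 S isOpen_interior (S.toComplex_mem_interior_offCut hr)
  refine ContinuousLinearMap.isUnit_of_forall_le_norm_inner_map _ (c := ⟨δ, hδ.le⟩) hδ fun u => ?_
  rw [norm_inner_symm, hrep, mul_comm]
  exact (h u).trans (Complex.re_le_norm _)

theorem exists_outgoing_domain : ∃ W : Set (ℂ × ℂ), IsOpen W ∧
    (∀ r : ℝ × ℝ, (∀ m : ℤ, S.etaSq m (toComplex r) ≠ 0) → toComplex r ∈ W) ∧
    S.IsBranch S.eta W ∧ ∀ p ∈ W, IsUnit (S.C1 S.eta p) := by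
  have hb := S.isBranch_eta
  refine ⟨interior S.offCut ∩ {p | IsUnit (S.C1 S.eta p)}, ?_, fun r hr =>
    ⟨S.toComplex_mem_interior_offCut hr, S.isUnit_C1_toComplex hr⟩,
    fun m => ⟨fun p hp => (hb m).1 p hp.1, fun p hp => (hb m).2 p hp.1⟩, fun p hp => hp.2⟩
  refine isOpen_iff_mem_nhds.2 fun p hp => inter_mem (isOpen_interior.mem_nhds hp.1) ?_
  exact eventually_isUnit_clm (hb.analyticAt_C1 S isOpen_interior hp.1).continuousAt hp.2

theorem etaSq_ne_zero_of_mem_diamond {r : ℝ × ℝ} (hr : r ∈ S.diamond) (m : ℤ) :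
    S.etaSq m (toComplex r) ≠ 0 := by
  obtain ⟨h1, h2, h3⟩ := hr
  rw [etaSq_toComplex, Complex.ofReal_ne_zero, realEtaSq]
  set t := r.2 * √(S.eps0 * S.mu0) with ht
  have hsq : S.eps0 * S.mu0 * r.2 ^ 2 = t ^ 2 := by
    rw [ht, mul_pow, Real.sq_sqrt (mul_pos S.eps0_pos S.mu0_pos).le, mul_comm]
  have ht0 : 0 ≤ t := (abs_nonneg _).trans h2.le
  rw [hsq, sub_ne_zero, ne_eq, sq_eq_sq_iff_abs_eq_abs, abs_of_nonneg ht0]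
  intro h
  rcases eq_or_ne m 0 with rfl | hm
  · rw [Int.cast_zero, zero_add] at h
    linarith
  · have hm1 : (1 : ℝ) ≤ |(m : ℝ)| := by exact_mod_cast Int.one_le_abs hm
    have : |(m : ℝ)| ≤ |(m : ℝ) + r.1| + |r.1| := by
      simpa using abs_sub ((m : ℝ) + r.1) r.1
    linarith

end Slab

theorem lemma2p2 (S : Slab) :
    -- analyticity wherever no `η_m²` vanishes, for every analytic choice of the `η_m`
    (∀ (U : Set (ℂ × ℂ)) (η : ℤ → ℂ × ℂ → ℂ), IsOpen U → S.IsBranch η U →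
      (∀ p ∈ U,
        (∀ u v : S.H1per, Summable
          (gammaTerm (dtn (fun m => η m p) (S.gammaCoeff u)) (S.gammaCoeff v))) ∧
        S.Represents (S.C1 η p) (S.c1 η p) ∧ S.Represents (S.C2 p) (S.c2 p)) ∧
      AnalyticOnNhd ℂ (S.C1 η) U ∧
      AnalyticOnNhd ℂ S.C2 U ∧
      (∀ p ∈ U, IsUnit (S.C1 η p) → AnalyticAt ℂ (S.A η) p)) ∧
    -- at every complex pair with nonvanishing `η_m²`, any choice of the square roots continues
    -- analytically to a common neighbourhood
    (∀ p : ℂ × ℂ, (∀ m : ℤ, S.etaSq m p ≠ 0) → ∀ e : ℤ → ℂ, (∀ m : ℤ, e m ^ 2 = S.etaSq m p) →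
      ∃ (U : Set (ℂ × ℂ)) (η : ℤ → ℂ × ℂ → ℂ), IsOpen U ∧ p ∈ U ∧ S.IsBranch η U ∧
        ∀ m : ℤ, η m p = e m) ∧
    -- near the real pairs, with the outgoing square roots: `C₁` is invertible and `A` is analytic
    (∃ W : Set (ℂ × ℂ), IsOpen W ∧
      (∀ r : ℝ × ℝ, (∀ m : ℤ, S.etaSq m (Slab.toComplex r) ≠ 0) → Slab.toComplex r ∈ W) ∧
      S.IsBranch S.eta W ∧
      (∀ p ∈ W, IsUnit (S.C1 S.eta p)) ∧
      AnalyticOnNhd ℂ (S.C1 S.eta) W ∧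
      AnalyticOnNhd ℂ S.C2 W ∧
      AnalyticOnNhd ℂ (S.A S.eta) W) ∧
    -- the condition on the `η_m²` holds on the diamond
    (∀ r ∈ S.diamond, ∀ m : ℤ, S.etaSq m (Slab.toComplex r) ≠ 0) := by
  refine ⟨fun U η hU hη => ⟨fun p hp => ⟨hη.summable_gammaTerm S hU hp, hη.represents_C1 S hU hp,
    S.represents_C2 p⟩, fun p hp => hη.analyticAt_C1 S hU hp, fun p _ => S.analyticAt_C2 p,
    fun p hp hu => hη.analyticAt_A S hU hp hu⟩, fun p hp e he => S.exists_isBranch hp he, ?_,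
    fun r hr => S.etaSq_ne_zero_of_mem_diamond hr⟩
  obtain ⟨W, hW, hreal, hη, hunit⟩ := S.exists_outgoing_domain
  exact ⟨W, hW, hreal, hη, hunit, fun p hp => hη.analyticAt_C1 S hW hp,
    fun p _ => S.analyticAt_C2 p, fun p hp => hη.analyticAt_A S hW hp (hunit p hp)⟩
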